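/- Let $\mu$ be a probability distribution on $\mathbb{R}$ with mean zero and finite second moment which satisfies the following condition (H): there are $M>0$ and $q\in(0,1)$ such that a random variable $\xi$ with law $\mu$ satisfies \[ \sup_{u\in\mathbb{R}}\mathbb{P}(|\xi-u|\le 1)\le 1-q\qquad\text{and}\qquad \mathbb{P}(|\xi|>M)\le q/2 . \] Let $\xi_0,\xi_1,\dots$ be i.i.d. real random variables with law $\mu$, and let $\mathcal{C}_n$ be the $n\times n$ random circulant matrix with first row $(\xi_0,\dots,\xi_{n-1})$, i.e. the matrix with entries $(\mathcal{C}_n)_{i,j}=\xi_{(j-i)\bmod n}$. For a square real matrix $A$ let $\sigma_{\max}(A)$ and $\sigma_{\min}(A)$ be its largest and smallest singular values, and let $\kappa(A)=\sigma_{\max}(A)/\sigma_{\min}(A)$ be its condition number, with $\kappa(A)=\infty$ if $A$ is singular. (1) Suppose in addition that $\mu$ has positive variance and that its moment generating function is finite on an open interval around $0$. Then there are constants $C_0,C_1>0$ and a real sequence $\delta_n\to 0$, depending only on $\mu$, such that for every $\varepsilon>0$ and every $\rho\in(0,1/4)$, for all sufficiently large $n$ (depending on $\mu,\varepsilon,\rho$),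 \[ \mathbb{P}\left(\kappa(\mathcal{C}_n)\le \frac{C_0}{\varepsilon}\,n^{\rho+1/2}(\log n)^{1/2}\right)\ \ge\ 1-C_1\left((\varepsilon^2+\varepsilon)\,n^{-2\rho}+n^{-1/2+\delta_n}\right). \] (2) Without the additional assumptions of (1), there are constants $C_0,C_2>0$, depending only on $\mu$, such that for every $\varepsilon>0$ and every $\rho\in(0,1/4)$, for all sufficiently large $n$ (depending on $\mu,\varepsilon,\rho$), \[ \mathbb{P}\left(\kappa(\mathcal{C}_n)\le \frac{C_0}{\varepsilon}\,n^{\rho+1/2}\log n\right)\ \ge\ 1-C_2\left((\varepsilon^2+\varepsilon)\,n^{-2\rho}+(\log n)^{-1/2}\right). \] -/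

import Mathlib

open MeasureTheory ProbabilityTheory Filter
open scoped ENNReal Topology

noncomputable section

/-- Condition (H) for a real random variable with law `μ`: for some `M > 0` and `q ∈ (0,1)`,
`sup_u P(|ξ - u| ≤ 1) ≤ 1 - q` and `P(|ξ| > M) ≤ q / 2`. -/
def ConditionH (μ : Measure ℝ) : Prop :=
  ∃ M q : ℝ, 0 < M ∧ 0 < q ∧ q < 1 ∧
    (∀ u : ℝ, μ.real {x | |x - u| ≤ 1} ≤ 1 - q) ∧ μ.real {x | M < |x|} ≤ q / 2

/-- The moment generating function of the law `μ` is finite on an open interval around zero. -/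
def HasMGFNearZero (μ : Measure ℝ) : Prop :=
  ∃ a : ℝ, 0 < a ∧ ∀ t ∈ Set.Ioo (-a) a, Integrable (fun x : ℝ => Real.exp (t * x)) μ

/-- `ξ 0, ξ 1, …` are independent random variables on `(Ω, P)`, all with law `μ`. -/
def IsIID {Ω : Type*} [MeasurableSpace Ω] (P : Measure Ω) (μ : Measure ℝ)
    (ξ : ℕ → Ω → ℝ) : Prop :=
  (∀ j, HasLaw (ξ j) μ P) ∧ iIndepFun ξ P

/-- The circulant matrix with first row `x 0, …, x (n-1)`; its `(i, j)` entry is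
`x ((j - i) mod n)`. -/
def circulantMatrix (n : ℕ) (x : ℕ → ℝ) : Matrix (Fin n) (Fin n) ℝ :=
  Matrix.of fun i j => x ((j - i : Fin n) : ℕ)

/-- The largest singular value (Mathlib indexes the singular values decreasingly from `0`). -/
def sigmaMax {n : ℕ} (A : Matrix (Fin n) (Fin n) ℝ) : ℝ :=
  (Matrix.toEuclideanLin A).singularValues 0

/-- The smallest of the `n` singular values. -/
def sigmaMin {n : ℕ} (A : Matrix (Fin n) (Fin n) ℝ) : ℝ :=
  (Matrix.toEuclideanLin A).singularValues (n - 1)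

open Classical in
/-- The condition number `σ_max / σ_min`, with value `∞` on singular matrices. -/
def conditionNumber {n : ℕ} (A : Matrix (Fin n) (Fin n) ℝ) : ℝ≥0∞ :=
  if sigmaMin A = 0 then ⊤ else ENNReal.ofReal (sigmaMax A / sigmaMin A)

end

/-!
A circulant matrix is normal and is diagonalised by the discrete Fourier transform, so its singular
values are the moduli `|∑ ξ_i z ^ i|` over the `n`-th roots of unity `z`, and the condition number
is at most `b / t` as soon as all of them lie in `[t, b]`.

*Lower bound.* By (H), the distance of two independent copies of `ξ` is in some `[1, R]`
with positive probability. Hence the characteristic function of `∑ ξ_i z ^ i` at a frequency `w` has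
modulus at most `exp (-c L)`, where `L` is the minimum of `∑_i (1 - cos (r Re (w z ^ i)))` over
`r ∈ [1, R]`, and `L` is at least of order `n min (|w| ^ 2, 1)` as long as `R |w|` is small compared
with the order `d ≥ 3` of `z`. Esseen's inequality turns this into
`P(|∑ ξ_i z ^ i| ≤ T) ≲ T ^ 2 / n + exp (-c n)` for `T ≳ 1 / d`. Taking `T = t + O(1 / d)` and
summing over `z`, the terms `1 / d ^ 2` contribute only `∑_{d ≤ n} 1 / d = O(log n)`, because there
are at most `d` roots of order `d`. For `z = ±1` the sum is real, and the one-dimensional estimate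
contributes `O(n ^ (-1 / 2))`.

*Upper bound.* If the moment generating function is finite near `0`, use the Chernoff bound and a
union bound over `z`. With only two moments, truncate at `√n`: the truncated variables obey the
Chernoff bound, and the removed part is small by Markov's inequality.
-/

section CirculantMatrix

open ComplexConjugate Polynomial

lemma sum_nthRootsFinset_pow_mul_conj_pow {n : ℕ} (i j : Fin n) :
    ∑ z ∈ nthRootsFinset n (1 : ℂ), z ^ (i : ℕ) * conj z ^ (j : ℕ) =
      if i = j then (n : ℂ) else 0 := by
  have hn : 0 < n := i.pos
  have hζ := Complex.isPrimitiveRoot_exp n hn.ne'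
  have hconj {z : ℂ} (hz : z ^ n = 1) : z * conj z = 1 := by
    simp [Complex.mul_conj', Complex.norm_eq_one_of_pow_eq_one hz hn.ne']
  split_ifs with hij
  · subst hij
    calc ∑ z ∈ nthRootsFinset n (1 : ℂ), z ^ (i : ℕ) * conj z ^ (i : ℕ)
        = ∑ z ∈ nthRootsFinset n (1 : ℂ), 1 := by
          refine Finset.sum_congr rfl fun z hz => ?_
          rw [← mul_pow, hconj ((mem_nthRootsFinset hn 1).1 hz), one_pow]
      _ = n := by simp [hζ.card_nthRootsFinset]
  · set ζ := Complex.exp (2 * Real.pi * Complex.I / n)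
    have hfactor : ζ ^ (i : ℕ) * conj ζ ^ (j : ℕ) ≠ 1 := by
      intro h
      refine hij (Fin.ext (hζ.pow_inj i.2 j.2 ?_))
      calc ζ ^ (i : ℕ) = ζ ^ (i : ℕ) * conj ζ ^ (j : ℕ) * ζ ^ (j : ℕ) := by
            rw [mul_assoc, ← mul_pow, mul_comm (conj ζ), hconj hζ.pow_eq_one, one_pow, mul_one]
        _ = ζ ^ (j : ℕ) := by rw [h, one_mul]
    have hinvariant : ζ ^ (i : ℕ) * conj ζ ^ (j : ℕ) *
        ∑ z ∈ nthRootsFinset n (1 : ℂ), z ^ (i : ℕ) * conj z ^ (j : ℕ) =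
        ∑ z ∈ nthRootsFinset n (1 : ℂ), z ^ (i : ℕ) * conj z ^ (j : ℕ) := by
      have hmem : ζ ∈ nthRootsFinset n (1 : ℂ) := hζ.mem_nthRootsFinset hn
      have hmem' : conj ζ ∈ nthRootsFinset n (1 : ℂ) := by
        rw [mem_nthRootsFinset hn, ← map_pow, hζ.pow_eq_one, map_one]
      have hζ1 := hconj hζ.pow_eq_one
      rw [Finset.mul_sum]
      refine Finset.sum_nbij' (ζ * ·) (conj ζ * ·)
        (fun z hz => by simpa using mul_mem_nthRootsFinset hmem hz)
        (fun z hz => by simpa using mul_mem_nthRootsFinset hmem' hz)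
        (fun z _ => by rw [← mul_assoc, mul_comm (conj ζ), hζ1, one_mul])
        (fun z _ => by rw [← mul_assoc, hζ1, one_mul]) fun z _ => ?_
      rw [map_mul]
      ring
    exact (mul_left_eq_self₀.1 hinvariant).resolve_left hfactor

/-- The polynomial with coefficients `v`, evaluated at `z`; restricted to the `n`-th roots of
unity this is the discrete Fourier transform of `v`. -/
noncomputable def dft {n : ℕ} (v : Fin n → ℝ) (z : ℂ) : ℂ := ∑ i, (v i : ℂ) * z ^ (i : ℕ)

lemma sum_norm_dft_sq {n : ℕ} (v : Fin n → ℝ) :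
    ∑ z ∈ nthRootsFinset n (1 : ℂ), ‖dft v z‖ ^ 2 = n * ∑ i, v i ^ 2 := by
  have hexpand (z : ℂ) : ((‖dft v z‖ ^ 2 : ℝ) : ℂ) =
      ∑ i, ∑ j, (v i * v j : ℂ) * (z ^ (i : ℕ) * conj z ^ (j : ℕ)) := by
    rw [Complex.ofReal_pow, ← Complex.mul_conj', dft, map_sum, Finset.sum_mul_sum]
    refine Finset.sum_congr rfl fun i _ => Finset.sum_congr rfl fun j _ => ?_
    rw [map_mul, map_pow, Complex.conj_ofReal]
    ring
  have hcomplex : ((∑ z ∈ nthRootsFinset n (1 : ℂ), ‖dft v z‖ ^ 2 : ℝ) : ℂ) =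
      ((n * ∑ i, v i ^ 2 : ℝ) : ℂ) := by
    calc ((∑ z ∈ nthRootsFinset n (1 : ℂ), ‖dft v z‖ ^ 2 : ℝ) : ℂ)
        = ∑ z ∈ nthRootsFinset n (1 : ℂ),
            ∑ i, ∑ j, (v i * v j : ℂ) * (z ^ (i : ℕ) * conj z ^ (j : ℕ)) := by
          rw [Complex.ofReal_sum]
          exact Finset.sum_congr rfl fun z _ => hexpand z
      _ = ∑ i, ∑ j, (v i * v j : ℂ) *
            ∑ z ∈ nthRootsFinset n (1 : ℂ), z ^ (i : ℕ) * conj z ^ (j : ℕ) := by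
          simp only [Finset.mul_sum]
          rw [Finset.sum_comm]
          exact Finset.sum_congr rfl fun i _ => Finset.sum_comm
      _ = ∑ i, (v i * v i : ℂ) * n := by
          simp only [sum_nthRootsFinset_pow_mul_conj_pow, mul_ite, mul_zero, Finset.sum_ite_eq,
            Finset.mem_univ, if_true]
      _ = ((n * ∑ i, v i ^ 2 : ℝ) : ℂ) := by
          push_cast
          rw [← Finset.sum_mul, mul_comm]
          simp only [sq]
  exact_mod_cast hcomplex

lemma pow_fin_sub_of_pow_eq_one {n : ℕ} {z : ℂ} (hz : z ^ n = 1) (i j : Fin n) :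
    z ^ ((i - j : Fin n) : ℕ) = z ^ (i : ℕ) * conj z ^ (j : ℕ) := by
  have hnorm : ‖z‖ = 1 := Complex.norm_eq_one_of_pow_eq_one hz (i.pos.ne')
  have hconj : z * conj z = 1 := by simp [Complex.mul_conj', hnorm]
  calc z ^ ((i - j : Fin n) : ℕ) = z ^ (n - (j : ℕ) + i) := by
        rw [Fin.sub_def]
        exact (pow_eq_pow_mod _ hz).symm
    _ = z ^ (n - (j : ℕ) + i) * (z * conj z) ^ (j : ℕ) := by rw [hconj, one_pow, mul_one]
    _ = z ^ (n - (j : ℕ) + j) * (z ^ (i : ℕ) * conj z ^ (j : ℕ)) := by ring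
    _ = z ^ (i : ℕ) * conj z ^ (j : ℕ) := by rw [Nat.sub_add_cancel j.2.le, hz, one_mul]

lemma dft_circulantMatrix_mulVec {n : ℕ} {z : ℂ} (hz : z ^ n = 1) (x : ℕ → ℝ) (v : Fin n → ℝ) :
    dft ((circulantMatrix n x).mulVec v) z = conj (dft (fun i : Fin n => x i) z) * dft v z := by
  have hterm (i j : Fin n) : (x ((j - i : Fin n) : ℕ) * v j : ℂ) * z ^ (i : ℕ) =
      (x ((j - i : Fin n) : ℕ) : ℂ) * conj z ^ ((j - i : Fin n) : ℕ) * (v j * z ^ (j : ℕ)) := by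
    have : NeZero n := ⟨i.pos.ne'⟩
    rw [← sub_sub_cancel j i, pow_fin_sub_of_pow_eq_one hz, sub_sub_cancel]
    ring
  calc dft ((circulantMatrix n x).mulVec v) z
      = ∑ i : Fin n, ∑ j : Fin n, (x ((j - i : Fin n) : ℕ) * v j : ℂ) * z ^ (i : ℕ) := by
        simp [dft, circulantMatrix, Matrix.mulVec, dotProduct, Finset.sum_mul]
    _ = ∑ j : Fin n, ∑ i : Fin n, (x ((j - i : Fin n) : ℕ) : ℂ) *
          conj z ^ ((j - i : Fin n) : ℕ) * (v j * z ^ (j : ℕ)) := by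
        rw [Finset.sum_comm]
        simp only [hterm]
    _ = ∑ j : Fin n, ∑ i : Fin n, (x i : ℂ) * conj z ^ (i : ℕ) * (v j * z ^ (j : ℕ)) := by
        refine Finset.sum_congr rfl fun j _ => ?_
        have : NeZero n := ⟨j.pos.ne'⟩
        exact (Equiv.subLeft j).sum_comp fun i : Fin n =>
          (x i : ℂ) * conj z ^ (i : ℕ) * (v j * z ^ (j : ℕ))
    _ = conj (dft (fun i : Fin n => x i) z) * dft v z := by
        rw [Finset.sum_comm, dft, dft, map_sum, Finset.sum_mul_sum]
        simp

lemma mul_norm_toEuclideanLin_circulantMatrix_sq {n : ℕ} (x : ℕ → ℝ)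
    (v : EuclideanSpace ℝ (Fin n)) :
    n * ‖Matrix.toEuclideanLin (circulantMatrix n x) v‖ ^ 2 = ∑ z ∈ nthRootsFinset n (1 : ℂ),
      ‖dft (fun i : Fin n => x i) z‖ ^ 2 * ‖dft v.ofLp z‖ ^ 2 := by
  rcases n.eq_zero_or_pos with rfl | hn
  · simp
  calc n * ‖Matrix.toEuclideanLin (circulantMatrix n x) v‖ ^ 2
      = ∑ z ∈ nthRootsFinset n (1 : ℂ), ‖dft ((circulantMatrix n x).mulVec v.ofLp) z‖ ^ 2 := by
        rw [sum_norm_dft_sq, EuclideanSpace.real_norm_sq_eq]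
        rfl
    _ = _ := by
        refine Finset.sum_congr rfl fun z hz => ?_
        rw [dft_circulantMatrix_mulVec ((mem_nthRootsFinset hn 1).1 hz), norm_mul, mul_pow,
          RCLike.norm_conj]

lemma mul_norm_sq_eq_sum_norm_dft_sq {n : ℕ} (v : EuclideanSpace ℝ (Fin n)) :
    n * ‖v‖ ^ 2 = ∑ z ∈ nthRootsFinset n (1 : ℂ), ‖dft v.ofLp z‖ ^ 2 := by
  rw [sum_norm_dft_sq, EuclideanSpace.real_norm_sq_eq]

lemma norm_toEuclideanLin_circulantMatrix_le {n : ℕ} {x : ℕ → ℝ} {b : ℝ} (hb : 0 ≤ b)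
    (h : ∀ z ∈ nthRootsFinset n (1 : ℂ), ‖dft (fun i : Fin n => x i) z‖ ≤ b)
    (v : EuclideanSpace ℝ (Fin n)) :
    ‖Matrix.toEuclideanLin (circulantMatrix n x) v‖ ≤ b * ‖v‖ := by
  rcases n.eq_zero_or_pos with rfl | hn
  · simp [Subsingleton.elim v 0]
  refine le_of_sq_le_sq (le_of_mul_le_mul_left ?_ (Nat.cast_pos.2 hn)) (by positivity)
  rw [mul_norm_toEuclideanLin_circulantMatrix_sq, mul_pow, mul_left_comm,
    mul_norm_sq_eq_sum_norm_dft_sq, Finset.mul_sum]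
  gcongr with z hz
  exact h z hz

lemma le_norm_toEuclideanLin_circulantMatrix {n : ℕ} {x : ℕ → ℝ} {a : ℝ} (ha : 0 ≤ a)
    (h : ∀ z ∈ nthRootsFinset n (1 : ℂ), a ≤ ‖dft (fun i : Fin n => x i) z‖)
    (v : EuclideanSpace ℝ (Fin n)) :
    a * ‖v‖ ≤ ‖Matrix.toEuclideanLin (circulantMatrix n x) v‖ := by
  rcases n.eq_zero_or_pos with rfl | hn
  · simp [Subsingleton.elim v 0]
  refine le_of_sq_le_sq (le_of_mul_le_mul_left ?_ (Nat.cast_pos.2 hn)) (norm_nonneg _)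
  rw [mul_norm_toEuclideanLin_circulantMatrix_sq, mul_pow, mul_left_comm,
    mul_norm_sq_eq_sum_norm_dft_sq, Finset.mul_sum]
  gcongr with z hz
  exact h z hz

section SingularValues

variable {𝕜 E F : Type*} [RCLike 𝕜] [NormedAddCommGroup E] [InnerProductSpace 𝕜 E]
  [FiniteDimensional 𝕜 E] [NormedAddCommGroup F] [InnerProductSpace 𝕜 F] [FiniteDimensional 𝕜 F]

open Module

lemma exists_norm_map_eq_singularValues_mul_norm (T : E →ₗ[𝕜] F) {i : ℕ}
    (hi : i < finrank 𝕜 E) : ∃ v ≠ 0, ‖T v‖ = T.singularValues i * ‖v‖ := by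
  obtain ⟨v, hv⟩ :=
    (T.hasEigenvalue_adjoint_comp_self_sq_singularValues hi).exists_hasEigenvector
  refine ⟨v, hv.2, ?_⟩
  have hsq : ‖T v‖ ^ 2 = (T.singularValues i * ‖v‖) ^ 2 := by
    have hinner := LinearMap.adjoint_inner_left T v (T v)
    rw [← LinearMap.comp_apply, hv.apply_eq_smul, inner_smul_left, inner_self_eq_norm_sq_to_K,
      inner_self_eq_norm_sq_to_K, map_pow, RCLike.conj_ofReal] at hinner
    rw [mul_pow]
    exact_mod_cast hinner.symm
  exact (sq_eq_sq₀ (norm_nonneg _) (mul_nonneg (T.singularValues_nonneg i) (norm_nonneg _))).1 hsq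

lemma singularValues_le_of_forall_norm_map_le {T : E →ₗ[𝕜] F} {b : ℝ}
    (h : ∀ v, ‖T v‖ ≤ b * ‖v‖) {i : ℕ} (hi : i < finrank 𝕜 E) : T.singularValues i ≤ b := by
  obtain ⟨v, hv, hTv⟩ := exists_norm_map_eq_singularValues_mul_norm T hi
  exact le_of_mul_le_mul_right (hTv ▸ h v) (norm_pos_iff.2 hv)

lemma le_singularValues_of_forall_le_norm_map {T : E →ₗ[𝕜] F} {a : ℝ}
    (h : ∀ v, a * ‖v‖ ≤ ‖T v‖) {i : ℕ} (hi : i < finrank 𝕜 E) : a ≤ T.singularValues i := by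
  obtain ⟨v, hv, hTv⟩ := exists_norm_map_eq_singularValues_mul_norm T hi
  exact le_of_mul_le_mul_right (hTv ▸ h v) (norm_pos_iff.2 hv)

end SingularValues

lemma conditionNumber_le_of_forall_norm {n : ℕ} (hn : n ≠ 0) {A : Matrix (Fin n) (Fin n) ℝ}
    {a b : ℝ} (ha : 0 < a) (hlower : ∀ v, a * ‖v‖ ≤ ‖Matrix.toEuclideanLin A v‖)
    (hupper : ∀ v, ‖Matrix.toEuclideanLin A v‖ ≤ b * ‖v‖) :
    conditionNumber A ≤ ENNReal.ofReal (b / a) := by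
  have hmin : a ≤ sigmaMin A :=
    le_singularValues_of_forall_le_norm_map hlower (by simpa using Nat.sub_one_lt hn)
  have hmax : sigmaMax A ≤ b :=
    singularValues_le_of_forall_norm_map_le hupper (by simpa using Nat.pos_of_ne_zero hn)
  have hmax_nonneg : 0 ≤ sigmaMax A := LinearMap.singularValues_nonneg _ _
  rw [conditionNumber, if_neg (ha.trans_le hmin).ne']
  exact ENNReal.ofReal_le_ofReal (div_le_div₀ (hmax_nonneg.trans hmax) hmax ha hmin)

lemma conditionNumber_circulantMatrix_le {n : ℕ} (hn : n ≠ 0) {x : ℕ → ℝ} {a b : ℝ} (ha : 0 < a)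
    (hb : 0 ≤ b) (hlower : ∀ z ∈ nthRootsFinset n (1 : ℂ), a ≤ ‖dft (fun i : Fin n => x i) z‖)
    (hupper : ∀ z ∈ nthRootsFinset n (1 : ℂ), ‖dft (fun i : Fin n => x i) z‖ ≤ b) :
    conditionNumber (circulantMatrix n x) ≤ ENNReal.ofReal (b / a) :=
  conditionNumber_le_of_forall_norm hn ha (le_norm_toEuclideanLin_circulantMatrix ha.le hlower)
    (norm_toEuclideanLin_circulantMatrix_le hb hupper)

end CirculantMatrix

section CosineSums

open Finset Real

lemma sum_range_pow_add_of_pow_eq_one {R M : Type*} [Monoid R] [AddCommMonoid M] {z : R} {n : ℕ}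
    (hz : z ^ n = 1) (f : R → M) (m : ℕ) :
    ∑ j ∈ range n, f (z ^ (j + m)) = ∑ j ∈ range n, f (z ^ j) := by
  induction m with
  | zero => simp
  | succ m ih =>
    cases n with
    | zero => simp
    | succ k =>
      have hwrap : z ^ (k + (m + 1)) = z ^ (0 + m) := by
        rw [← add_assoc, add_right_comm, pow_add, hz, one_mul, zero_add]
      rw [← ih, sum_range_succ, sum_range_succ', hwrap]
      exact congrArg (· + _) (sum_congr rfl fun j _ => by rw [add_assoc, add_comm 1 m])

lemma sum_range_re_mul_pow_sq {z : ℂ} {n : ℕ} (hz : z ^ n = 1) (hz2 : z ^ 2 ≠ 1) (w : ℂ) :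
    ∑ j ∈ range n, (w * z ^ j).re ^ 2 = n * ‖w‖ ^ 2 / 2 := by
  rcases eq_or_ne n 0 with rfl | hn
  · simp
  have hre_sq (u : ℂ) : u.re ^ 2 = ‖u‖ ^ 2 / 2 + (u ^ 2).re / 2 := by
    rw [← Complex.normSq_eq_norm_sq, Complex.normSq_apply, sq u, Complex.mul_re]
    ring
  have hgeom : ∑ j ∈ range n, (w * z ^ j) ^ 2 = 0 := by
    calc ∑ j ∈ range n, (w * z ^ j) ^ 2 = w ^ 2 * ∑ j ∈ range n, (z ^ 2) ^ j := by
          rw [mul_sum]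
          exact sum_congr rfl fun j _ => by ring
      _ = 0 := by rw [geom_sum_eq hz2, ← pow_mul, mul_comm 2 n, pow_mul, hz]; simp
  simp only [hre_sq, sum_add_distrib, ← sum_div, ← Complex.re_sum, hgeom, norm_mul, norm_pow,
    Complex.norm_eq_one_of_pow_eq_one hz hn]
  simp

lemma div_pi_sq_mul_norm_sq_le_sum_one_sub_cos {z : ℂ} {n : ℕ} (hz : z ^ n = 1) (hz2 : z ^ 2 ≠ 1)
    {w : ℂ} (hw : ‖w‖ ≤ π) :
    n / π ^ 2 * ‖w‖ ^ 2 ≤ ∑ j ∈ range n, (1 - cos (w * z ^ j).re) := by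
  rcases eq_or_ne n 0 with rfl | hn
  · simp
  calc n / π ^ 2 * ‖w‖ ^ 2 = ∑ j ∈ range n, 2 / π ^ 2 * (w * z ^ j).re ^ 2 := by
        rw [← mul_sum, sum_range_re_mul_pow_sq hz hz2]
        ring
    _ ≤ ∑ j ∈ range n, (1 - cos (w * z ^ j).re) := by
        refine sum_le_sum fun j _ => ?_
        have habs : |(w * z ^ j).re| ≤ π := (Complex.abs_re_le_norm _).trans <| by
          rwa [norm_mul, norm_pow, Complex.norm_eq_one_of_pow_eq_one hz hn, one_pow, mul_one]
        linarith [cos_le_one_sub_mul_cos_sq habs]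

lemma one_sub_cos_sub_le (a b : ℝ) :
    1 - cos (a - b) ≤ 2 * (1 - cos a) + 2 * (1 - cos b) := by
  rw [cos_sub]
  nlinarith [sin_sq_add_cos_sq a, sin_sq_add_cos_sq b, sq_nonneg (sin a + sin b),
    sq_nonneg (cos a + cos b - 2)]

lemma sum_one_sub_cos_mul_pow_sub_one_le {z : ℂ} {n : ℕ} (hz : z ^ n = 1) (w : ℂ) (m : ℕ) :
    ∑ j ∈ range n, (1 - cos (w * (z ^ m - 1) * z ^ j).re) ≤
      4 * ∑ j ∈ range n, (1 - cos (w * z ^ j).re) := by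
  have hterm (j : ℕ) : 1 - cos (w * (z ^ m - 1) * z ^ j).re ≤
      2 * (1 - cos (w * z ^ (j + m)).re) + 2 * (1 - cos (w * z ^ j).re) := by
    rw [show w * (z ^ m - 1) * z ^ j = w * z ^ (j + m) - w * z ^ j by ring, Complex.sub_re]
    exact one_sub_cos_sub_le _ _
  calc ∑ j ∈ range n, (1 - cos (w * (z ^ m - 1) * z ^ j).re)
      ≤ ∑ j ∈ range n,
          (2 * (1 - cos (w * z ^ (j + m)).re) + 2 * (1 - cos (w * z ^ j).re)) :=
        sum_le_sum fun j _ => hterm j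
    _ = 4 * ∑ j ∈ range n, (1 - cos (w * z ^ j).re) := by
        rw [sum_add_distrib, ← mul_sum, ← mul_sum,
          sum_range_pow_add_of_pow_eq_one hz (fun u => 1 - cos (w * u).re)]
        ring

lemma exists_one_le_norm_pow_sub_one_of_isPrimitiveRoot {ζ : ℂ} {d : ℕ} (hζ : IsPrimitiveRoot ζ d)
    (hd : 1 < d) : ∃ l : ℕ, 1 ≤ ‖ζ ^ l - 1‖ := by
  by_contra! h
  have hre_pos (l : ℕ) : 0 < (ζ ^ l).re := by
    have := (Complex.abs_re_le_norm _).trans_lt (h l)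
    rw [Complex.sub_re, Complex.one_re, abs_lt] at this
    linarith
  have hsum_pos : 0 < ∑ l ∈ range d, (ζ ^ l).re :=
    sum_pos (fun l _ => hre_pos l) (nonempty_range_iff.2 (by omega))
  rw [← Complex.re_sum, hζ.geom_sum_eq_zero hd, Complex.zero_re] at hsum_pos
  exact hsum_pos.false

lemma norm_exp_two_pi_mul_I_div_sub_one_le (d : ℕ) :
    ‖Complex.exp (2 * π * Complex.I / d) - 1‖ ≤ 2 * π / d := by
  rw [show 2 * π * Complex.I / d = Complex.I * (2 * π / d : ℝ) by push_cast; ring]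
  refine norm_exp_I_mul_ofReal_sub_one_le.trans_eq ?_
  rw [norm_eq_abs, abs_of_nonneg (by positivity)]

lemma exists_norm_mul_pow_sub_one_mem_Icc_of_norm_le_one {ζ w : ℂ} (hζ : ‖ζ‖ = 1)
    (hstep : ‖w * (ζ - 1)‖ ≤ 1) (hex : ∃ l : ℕ, 1 ≤ ‖w * (ζ ^ l - 1)‖) :
    ∃ l : ℕ, ‖w * (ζ ^ l - 1)‖ ∈ Set.Icc 1 2 := by
  obtain ⟨l, hl, hmin⟩ : ∃ l : ℕ, 1 ≤ ‖w * (ζ ^ l - 1)‖ ∧ ∀ k < l, ‖w * (ζ ^ k - 1)‖ < 1 := by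
    classical
    exact ⟨Nat.find hex, Nat.find_spec hex, fun k hk => not_le.1 (Nat.find_min hex hk)⟩
  refine ⟨l, hl, ?_⟩
  cases l with
  | zero => simp
  | succ k =>
    calc ‖w * (ζ ^ (k + 1) - 1)‖ = ‖w * (ζ ^ k - 1) * ζ + w * (ζ - 1)‖ := by ring_nf
      _ ≤ ‖w * (ζ ^ k - 1) * ζ‖ + ‖w * (ζ - 1)‖ := norm_add_le _ _
      _ ≤ 1 + 1 := by
          rw [norm_mul _ ζ, hζ, mul_one]
          exact add_le_add (hmin k k.lt_succ_self).le hstep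
      _ = 2 := one_add_one_eq_two

lemma exists_norm_mul_pow_sub_one_mem_Icc {z w : ℂ} (hz : 2 ≤ orderOf z) (hw : 1 ≤ ‖w‖)
    (hwz : 2 * π * ‖w‖ ≤ orderOf z) : ∃ m : ℕ, ‖w * (z ^ m - 1)‖ ∈ Set.Icc 1 2 := by
  set d := orderOf z
  have hd0 : d ≠ 0 := by omega
  have : NeZero d := ⟨hd0⟩
  set ζ := Complex.exp (2 * π * Complex.I / d)
  have hζ : IsPrimitiveRoot ζ d := Complex.isPrimitiveRoot_exp d hd0
  obtain ⟨a, -, ha⟩ := (IsPrimitiveRoot.orderOf z).eq_pow_of_pow_eq_one hζ.pow_eq_one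
  have hstep : ‖w * (ζ - 1)‖ ≤ 1 := by
    calc ‖w * (ζ - 1)‖ ≤ ‖w‖ * (2 * π / d) := by
          rw [norm_mul]
          gcongr
          exact norm_exp_two_pi_mul_I_div_sub_one_le d
      _ = 2 * π * ‖w‖ / d := by ring
      _ ≤ 1 := (div_le_one (by positivity)).2 hwz
  have hfar : ∃ l : ℕ, 1 ≤ ‖w * (ζ ^ l - 1)‖ := by
    obtain ⟨l, hl⟩ := exists_one_le_norm_pow_sub_one_of_isPrimitiveRoot hζ hz
    exact ⟨l, by rw [norm_mul]; exact one_le_mul_of_one_le_of_one_le hw hl⟩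
  obtain ⟨l, hl⟩ := exists_norm_mul_pow_sub_one_mem_Icc_of_norm_le_one
    (Complex.norm_eq_one_of_pow_eq_one hζ.pow_eq_one hd0) hstep hfar
  exact ⟨a * l, by rwa [pow_mul, ha]⟩

lemma mul_min_norm_sq_one_le_sum_one_sub_cos {z w : ℂ} {n : ℕ} (hz : z ^ n = 1)
    (hz3 : 3 ≤ orderOf z) (hwz : 2 * π * ‖w‖ ≤ orderOf z) :
    n / (4 * π ^ 2) * min (‖w‖ ^ 2) 1 ≤ ∑ j ∈ range n, (1 - cos (w * z ^ j).re) := by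
  have hz2 : z ^ 2 ≠ 1 := fun h => by
    have := Nat.le_of_dvd two_pos (orderOf_dvd_of_pow_eq_one h)
    omega
  rcases le_total ‖w‖ 1 with hw | hw
  · calc n / (4 * π ^ 2) * min (‖w‖ ^ 2) 1 ≤ n / π ^ 2 * ‖w‖ ^ 2 := by
          gcongr
          · linarith [sq_nonneg π]
          · exact min_le_left _ _
      _ ≤ ∑ j ∈ range n, (1 - cos (w * z ^ j).re) :=
          div_pi_sq_mul_norm_sq_le_sum_one_sub_cos hz hz2 (hw.trans (by linarith [pi_gt_three]))
  · -- Some difference `w z ^ m - w` has modulus in `[1, 2]`, where the quadratic bound applies.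
    obtain ⟨m, hm1, hm2⟩ := exists_norm_mul_pow_sub_one_mem_Icc (by omega) hw hwz
    refine le_of_mul_le_mul_left ?_ (four_pos (α := ℝ))
    calc 4 * (n / (4 * π ^ 2) * min (‖w‖ ^ 2) 1) ≤ 4 * (n / (4 * π ^ 2) * 1) := by
          gcongr
          exact min_le_right _ _
      _ = n / π ^ 2 * 1 := by ring
      _ ≤ n / π ^ 2 * ‖w * (z ^ m - 1)‖ ^ 2 := by
          gcongr
          exact one_le_pow₀ hm1
      _ ≤ ∑ j ∈ range n, (1 - cos (w * (z ^ m - 1) * z ^ j).re) :=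
          div_pi_sq_mul_norm_sq_le_sum_one_sub_cos hz hz2 (hm2.trans (by linarith [pi_gt_three]))
      _ ≤ 4 * ∑ j ∈ range n, (1 - cos (w * z ^ j).re) :=
          sum_one_sub_cos_mul_pow_sub_one_le hz w m

end CosineSums

section Esseen

open scoped RealInnerProductSpace

variable {E : Type*} [NormedAddCommGroup E] [InnerProductSpace ℝ E] [MeasurableSpace E]
  [BorelSpace E] [SecondCountableTopology E]

lemma integral_charFun_comm (μ ν : Measure E) [IsFiniteMeasure μ] [IsFiniteMeasure ν] :
    ∫ x, charFun ν x ∂μ = ∫ t, charFun μ t ∂ν := by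
  simp only [charFun_apply]
  rw [integral_integral_swap]
  · simp only [real_inner_comm]
  · refine Integrable.of_bound (by fun_prop) 1 (ae_of_all _ fun p => ?_)
    rw [Function.uncurry_apply_pair, Complex.norm_exp_ofReal_mul_I]

lemma integrable_charFun (μ ν : Measure E) [IsProbabilityMeasure μ] [IsFiniteMeasure ν] :
    Integrable (charFun μ) ν :=
  Integrable.of_bound measurable_charFun.aestronglyMeasurable 1
    (ae_of_all _ fun _ => norm_charFun_le_one _)

/-- Esseen's inequality, with an arbitrary smoothing kernel `ν`. -/
lemma mul_measureReal_closedBall_le_integral_norm_charFun (μ ν : Measure E)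
    [IsProbabilityMeasure μ] [IsProbabilityMeasure ν] {c : ℝ} (hν : ∀ x, 0 ≤ (charFun ν x).re)
    (hc : ∀ x, ‖x‖ ≤ 1 → c ≤ (charFun ν x).re) :
    c * μ.real (Metric.closedBall 0 1) ≤ ∫ t, ‖charFun μ t‖ ∂ν := by
  calc c * μ.real (Metric.closedBall 0 1)
      = ∫ x, (Metric.closedBall (0 : E) 1).indicator (fun _ => c) x ∂μ := by
        rw [integral_indicator_const _ Metric.isClosed_closedBall.measurableSet, smul_eq_mul,
          mul_comm]
    _ ≤ ∫ x, (charFun ν x).re ∂μ := by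
        refine integral_mono ((integrable_const c).indicator
          Metric.isClosed_closedBall.measurableSet) (integrable_charFun ν μ).re fun x => ?_
        exact Set.indicator_apply_le' (fun hx => hc x (mem_closedBall_zero_iff.1 hx))
          fun _ => hν x
    _ = (∫ t, charFun μ t ∂ν).re := by
        rw [← integral_charFun_comm]
        exact integral_re (integrable_charFun ν μ)
    _ ≤ ‖∫ t, charFun μ t ∂ν‖ := Complex.re_le_norm _
    _ ≤ ∫ t, ‖charFun μ t‖ ∂ν := norm_integral_le_integral_norm _

end Esseen

lemma integral_exp_neg_mul_norm_sq_le {E : Type*} [NormedAddCommGroup E] [InnerProductSpace ℝ E]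
    [FiniteDimensional ℝ E] [MeasurableSpace E] [BorelSpace E] {ν : Measure E} {c : ℝ}
    (hc : 0 ≤ c) (hν : ν ≤ ENNReal.ofReal c • volume) {a : ℝ} (ha : 0 < a) :
    ∫ v, Real.exp (-a * ‖v‖ ^ 2) ∂ν ≤ c * (Real.pi / a) ^ (Module.finrank ℝ E / 2 : ℝ) := by
  rw [← GaussianFourier.integral_rexp_neg_mul_sq_norm ha]
  have hint : Integrable (fun v : E => Real.exp (-a * ‖v‖ ^ 2)) := by
    refine Integrable.of_integral_ne_zero ?_
    rw [GaussianFourier.integral_rexp_neg_mul_sq_norm ha]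
    positivity
  calc ∫ v, Real.exp (-a * ‖v‖ ^ 2) ∂ν
      ≤ ∫ v, Real.exp (-a * ‖v‖ ^ 2) ∂(ENNReal.ofReal c • volume) :=
        integral_mono_measure hν (ae_of_all _ fun v => (Real.exp_pos _).le)
          (hint.smul_measure ENNReal.ofReal_ne_top)
    _ = c * ∫ v : E, Real.exp (-a * ‖v‖ ^ 2) := by
        rw [integral_smul_measure, ENNReal.toReal_ofReal hc, smul_eq_mul]

section TriangleMeasure

/-- The uniform distribution on `[-1, 1]`. -/
noncomputable def uniformMeasure : Measure ℝ := volume[|Set.Icc (-1) 1]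

instance : IsProbabilityMeasure uniformMeasure :=
  cond_isProbabilityMeasure_of_finite (by simp) (by simp)

lemma uniformMeasure_eq :
    uniformMeasure = ENNReal.ofReal (1 / 2) • volume.restrict (Set.Icc (-1 : ℝ) 1) := by
  rw [uniformMeasure, ProbabilityTheory.cond, Real.volume_Icc,
    ← ENNReal.ofReal_inv_of_pos (by norm_num)]
  norm_num

lemma uniformMeasure_le : uniformMeasure ≤ ENNReal.ofReal (1 / 2) • volume := by
  rw [uniformMeasure_eq]
  gcongr
  exact Measure.restrict_le_self

lemma charFun_uniformMeasure (t : ℝ) : charFun uniformMeasure t = Real.sinc t := by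
  rcases eq_or_ne t 0 with rfl | ht
  · simp
  have hscale := intervalIntegral.integral_comp_mul_left (a := -1) (b := 1)
    (fun x : ℝ => Complex.exp (x * Complex.I)) ht
  simp only [mul_neg, mul_one, Complex.ofReal_mul] at hscale
  have ht' : (t : ℂ) ≠ 0 := by exact_mod_cast ht
  rw [charFun_apply_real, uniformMeasure_eq, integral_smul_measure, integral_Icc_eq_integral_Ioc,
    ← intervalIntegral.integral_of_le (by norm_num), hscale, integral_exp_mul_I_eq_sinc,
    ENNReal.toReal_ofReal (by norm_num)]
  simp only [Complex.real_smul]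
  push_cast
  field_simp

/-- The law of the sum of two independent uniform variables on `[-1, 1]`. It serves as a smoothing
kernel because it is compactly supported and its characteristic function is nonnegative. -/
noncomputable def triangleMeasure : Measure ℝ := uniformMeasure ∗ uniformMeasure

instance : IsProbabilityMeasure triangleMeasure := by
  rw [triangleMeasure]
  infer_instance

lemma charFun_triangleMeasure (t : ℝ) : charFun triangleMeasure t = (Real.sinc t ^ 2 : ℝ) := by
  rw [triangleMeasure, charFun_conv, charFun_uniformMeasure, Complex.ofReal_pow, sq]

lemma half_le_sinc_sq {x : ℝ} (hx : |x| ≤ 1) : 1 / 2 ≤ Real.sinc x ^ 2 := by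
  wlog hpos : 0 ≤ x generalizing x
  · rw [← Real.sinc_neg]
    exact this (by rwa [abs_neg]) (by linarith)
  rcases hpos.eq_or_lt with rfl | hx0
  · norm_num
  have hx1 : x ≤ 1 := (abs_le.1 hx).2
  have hsin : 5 / 6 * x ≤ Real.sin x := by
    nlinarith [Real.sin_gt_sub_cube hx0, mul_nonneg hx0.le (sub_nonneg.2 hx1),
      mul_nonneg (mul_nonneg hx0.le hx0.le) (sub_nonneg.2 hx1)]
  have hsinc : 5 / 6 ≤ Real.sinc x := by
    rwa [Real.sinc_of_ne_zero hx0.ne', le_div_iff₀ hx0]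
  nlinarith

lemma conv_le_smul_volume {μ ν : Measure ℝ} [IsProbabilityMeasure μ] [SFinite ν] {c : ℝ≥0∞}
    (hν : ν ≤ c • volume) : μ ∗ ν ≤ c • volume := by
  refine Measure.le_iff.2 fun s hs => ?_
  calc (μ ∗ ν) s = ∫⁻ x, ν ((x + ·) ⁻¹' s) ∂μ := by
        rw [Measure.conv, Measure.map_apply (by fun_prop) hs,
          Measure.prod_apply (measurable_add hs)]
        rfl
    _ ≤ ∫⁻ _, (c • volume) s ∂μ := by
        refine lintegral_mono fun x => (hν _).trans_eq ?_
        rw [Measure.smul_apply, measure_preimage_add, Measure.smul_apply]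
    _ = (c • volume) s := by rw [lintegral_const, measure_univ, mul_one]

lemma triangleMeasure_le : triangleMeasure ≤ ENNReal.ofReal (1 / 2) • volume :=
  conv_le_smul_volume uniformMeasure_le

lemma ae_abs_le_one_uniformMeasure : ∀ᵐ u ∂uniformMeasure, |u| ≤ 1 := by
  filter_upwards [ae_cond_mem measurableSet_Icc] with u hu using abs_le.2 hu

lemma ae_abs_le_two_triangleMeasure : ∀ᵐ u ∂triangleMeasure, |u| ≤ 2 := by
  rw [triangleMeasure, Measure.conv,
    ae_map_iff (by fun_prop) (measurableSet_le (by fun_prop) (by fun_prop))]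
  filter_upwards [Measure.quasiMeasurePreserving_fst.ae ae_abs_le_one_uniformMeasure,
    Measure.quasiMeasurePreserving_snd.ae ae_abs_le_one_uniformMeasure] with p h1 h2
  exact (abs_add_le _ _).trans (by linarith)

/-- The law of `U + iV` for independent `U` and `V` with law `triangleMeasure`, the smoothing
kernel on the complex plane. -/
noncomputable def complexTriangleMeasure : Measure ℂ :=
  (triangleMeasure.prod triangleMeasure).map Complex.measurableEquivRealProd.symm

instance : IsProbabilityMeasure complexTriangleMeasure :=
  Measure.isProbabilityMeasure_map Complex.measurableEquivRealProd.symm.measurable.aemeasurable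

lemma charFun_complexTriangleMeasure (w : ℂ) :
    charFun complexTriangleMeasure w = (Real.sinc w.re ^ 2 * Real.sinc w.im ^ 2 : ℝ) := by
  rw [charFun_apply, complexTriangleMeasure, integral_map_equiv]
  calc ∫ p, Complex.exp (inner ℝ (Complex.measurableEquivRealProd.symm p) w * Complex.I)
        ∂(triangleMeasure.prod triangleMeasure)
      = ∫ p : ℝ × ℝ, Complex.exp (w.re * p.1 * Complex.I) * Complex.exp (w.im * p.2 * Complex.I)
          ∂(triangleMeasure.prod triangleMeasure) := by
        refine integral_congr_ae (ae_of_all _ fun p => ?_)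
        simp only [Complex.inner, ← Complex.exp_add]
        congr 1
        simp [Complex.measurableEquivRealProd]
        ring
    _ = charFun triangleMeasure w.re * charFun triangleMeasure w.im := by
        rw [integral_prod_mul (fun x : ℝ => Complex.exp (w.re * x * Complex.I))
          (fun x : ℝ => Complex.exp (w.im * x * Complex.I)), ← charFun_apply_real,
          ← charFun_apply_real]
    _ = _ := by
        rw [charFun_triangleMeasure, charFun_triangleMeasure, Complex.ofReal_mul]

lemma complexTriangleMeasure_le : complexTriangleMeasure ≤ ENNReal.ofReal (1 / 4) • volume := by
  have hprod : triangleMeasure.prod triangleMeasure ≤ ENNReal.ofReal (1 / 4) • volume := by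
    refine (Measure.prod_mono triangleMeasure_le triangleMeasure_le).trans_eq ?_
    rw [Measure.prod_smul_left, Measure.prod_smul_right, smul_smul,
      ← ENNReal.ofReal_mul (by norm_num), Measure.volume_eq_prod]
    norm_num
  refine (Measure.map_mono hprod Complex.measurableEquivRealProd.symm.measurable).trans_eq ?_
  rw [Measure.map_smul, Complex.volume_preserving_equiv_real_prod.symm.map_eq]

lemma ae_norm_le_three_complexTriangleMeasure : ∀ᵐ w ∂complexTriangleMeasure, ‖w‖ ≤ 3 := by
  rw [complexTriangleMeasure, ae_map_iff (by fun_prop) (measurableSet_le (by fun_prop)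
    measurable_const)]
  filter_upwards [Measure.quasiMeasurePreserving_fst.ae ae_abs_le_two_triangleMeasure,
    Measure.quasiMeasurePreserving_snd.ae ae_abs_le_two_triangleMeasure] with p h1 h2
  refine le_of_sq_le_sq ?_ (by norm_num)
  rw [← Complex.normSq_eq_norm_sq, Complex.normSq_apply]
  simp only [Complex.measurableEquivRealProd_symm_apply]
  nlinarith [sq_abs p.1, sq_abs p.2, abs_nonneg p.1, abs_nonneg p.2]

end TriangleMeasure

section CharFunBound

variable (μ : Measure ℝ) [IsProbabilityMeasure μ]

lemma norm_charFun_sq_eq_integral_cos (s : ℝ) :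
    ‖charFun μ s‖ ^ 2 = ∫ p : ℝ × ℝ, Real.cos (s * (p.1 - p.2)) ∂(μ.prod μ) := by
  have hexp : ((‖charFun μ s‖ ^ 2 : ℝ) : ℂ)
      = ∫ p : ℝ × ℝ, Complex.exp ((s * (p.1 - p.2) : ℝ) * Complex.I) ∂(μ.prod μ) := by
    rw [← Complex.normSq_eq_norm_sq, ← Complex.mul_conj, ← charFun_neg, charFun_apply_real,
      charFun_apply_real, ← integral_prod_mul]
    refine integral_congr_ae (ae_of_all _ fun p => ?_)
    simp only [← Complex.exp_add]
    congr 1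
    push_cast
    ring
  have hint : Integrable (fun p : ℝ × ℝ => Complex.exp ((s * (p.1 - p.2) : ℝ) * Complex.I))
      (μ.prod μ) :=
    Integrable.of_bound (by fun_prop) 1 (ae_of_all _ fun p => by rw [Complex.norm_exp_ofReal_mul_I])
  rw [← Complex.ofReal_re (‖charFun μ s‖ ^ 2), hexp]
  exact (integral_re hint).symm.trans (by simp only [RCLike.re_eq_complex_re,
    Complex.exp_ofReal_mul_I_re])

lemma integrable_one_sub_cos_mul_sub (s : ℝ) :
    Integrable (fun p : ℝ × ℝ => 1 - Real.cos (s * (p.1 - p.2))) (μ.prod μ) :=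
  (integrable_const 1).sub
    (Integrable.of_bound (by fun_prop) 1 (ae_of_all _ fun _ => Real.abs_cos_le_one _))

lemma norm_charFun_le_exp (s : ℝ) :
    ‖charFun μ s‖ ≤
      Real.exp (-(1 / 2) * ∫ p : ℝ × ℝ, (1 - Real.cos (s * (p.1 - p.2))) ∂(μ.prod μ)) := by
  have hint : Integrable (fun p : ℝ × ℝ => Real.cos (s * (p.1 - p.2))) (μ.prod μ) :=
    Integrable.of_bound (by fun_prop) 1 (ae_of_all _ fun _ => Real.abs_cos_le_one _)
  rw [integral_sub (integrable_const _) hint, ← norm_charFun_sq_eq_integral_cos, integral_const,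
    probReal_univ, one_smul]
  refine le_of_sq_le_sq ?_ (Real.exp_pos _).le
  rw [← Real.exp_nat_mul]
  have := Real.add_one_le_exp ((2 : ℕ) * (-(1 / 2) * (1 - ‖charFun μ s‖ ^ 2)))
  push_cast at this ⊢
  linarith

/-- The probability that two independent variables with law `μ` lie at a distance in `[1, M]`. It
quantifies the non-degeneracy of `μ` at scale one. -/
noncomputable def gapProb (M : ℝ) : ℝ :=
  (μ.prod μ).real {p : ℝ × ℝ | |p.1 - p.2| ∈ Set.Icc 1 M}

lemma prod_norm_charFun_le_exp_neg_gapProb {ι : Type*} (s : Finset ι) (f : ι → ℝ) {M L : ℝ}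
    (hL : ∀ y : ℝ, |y| ∈ Set.Icc 1 M → L ≤ ∑ i ∈ s, (1 - Real.cos (f i * y))) :
    ∏ i ∈ s, ‖charFun μ (f i)‖ ≤ Real.exp (-(gapProb μ M / 2) * L) := by
  set A := {p : ℝ × ℝ | |p.1 - p.2| ∈ Set.Icc 1 M}
  have hA : MeasurableSet A :=
    (by fun_prop : Measurable fun p : ℝ × ℝ => |p.1 - p.2|) measurableSet_Icc
  have hgap : gapProb μ M * L
      ≤ ∫ p : ℝ × ℝ, ∑ i ∈ s, (1 - Real.cos (f i * (p.1 - p.2))) ∂(μ.prod μ) := by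
    calc gapProb μ M * L = ∫ p, A.indicator (fun _ => L) p ∂(μ.prod μ) := by
          rw [integral_indicator_const _ hA, smul_eq_mul, gapProb]
      _ ≤ _ := integral_mono ((integrable_const L).indicator hA)
          (integrable_finsetSum _ fun i _ => integrable_one_sub_cos_mul_sub μ (f i)) fun p =>
          Set.indicator_apply_le' (fun hp => hL _ hp)
            fun _ => Finset.sum_nonneg fun i _ => sub_nonneg.2 (Real.cos_le_one _)
  calc ∏ i ∈ s, ‖charFun μ (f i)‖
      ≤ ∏ i ∈ s, Real.exp (-(1 / 2) *
          ∫ p : ℝ × ℝ, (1 - Real.cos (f i * (p.1 - p.2))) ∂(μ.prod μ)) :=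
        Finset.prod_le_prod (fun _ _ => norm_nonneg _) fun i _ => norm_charFun_le_exp μ (f i)
    _ = Real.exp (-(1 / 2) * ∫ p : ℝ × ℝ, ∑ i ∈ s,
          (1 - Real.cos (f i * (p.1 - p.2))) ∂(μ.prod μ)) := by
        rw [← Real.exp_sum, ← Finset.mul_sum,
          integral_finsetSum _ fun i _ => integrable_one_sub_cos_mul_sub μ (f i)]
    _ ≤ Real.exp (-(gapProb μ M / 2) * L) := Real.exp_le_exp.2 (by linarith)

end CharFunBound

lemma ConditionH.exists_gapProb_pos {μ : Measure ℝ} [IsProbabilityMeasure μ] (h : ConditionH μ) :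
    ∃ M, 0 < M ∧ 0 < gapProb μ M := by
  obtain ⟨M, q, hM, hq, hq1, hconc, htail⟩ := h
  refine ⟨2 * M, by positivity, ?_⟩
  by_contra! hgap
  have hnull : (μ.prod μ) {p : ℝ × ℝ | |p.1 - p.2| ∈ Set.Icc 1 (2 * M)} = 0 := by
    rw [← measureReal_eq_zero_iff]
    exact hgap.antisymm measureReal_nonneg
  have hslice : ∀ᵐ x ∂μ, μ.real {y | |x - y| ∈ Set.Icc 1 (2 * M)} = 0 := by
    filter_upwards [Measure.measure_ae_null_of_prod_null hnull] with x hx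
    exact (measureReal_eq_zero_iff).2 hx
  have hlarge : ∀ᵐ x ∂μ, M < |x| := by
    filter_upwards [hslice] with x hx
    by_contra! hxM
    have hcover : Set.univ ⊆
        {y | |x - y| ∈ Set.Icc 1 (2 * M)} ∪ ({y | |y - x| ≤ 1} ∪ {y | M < |y|}) := by
      intro y _
      by_contra! hy
      simp only [Set.mem_union, Set.mem_ofPred_eq, Set.mem_Icc, not_or, not_and, not_le,
        not_lt] at hy
      obtain ⟨hy, hyx, hyM⟩ := hy
      rw [abs_sub_comm] at hyx
      linarith [hy hyx.le, abs_sub x y]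
    have h1 := measureReal_mono (μ := μ) hcover
    have h2 := measureReal_union_le (μ := μ) {y | |x - y| ∈ Set.Icc 1 (2 * M)}
      ({y | |y - x| ≤ 1} ∪ {y | M < |y|})
    have h3 := measureReal_union_le (μ := μ) {y | |y - x| ≤ 1} {y | M < |y|}
    rw [probReal_univ] at h1
    linarith [hconc x]
  have : μ.real {x | M < |x|} = 1 := by
    rw [measureReal_def, (mem_ae_iff_prob_eq_one (measurableSet_lt measurable_const
      (by fun_prop))).1 hlarge, ENNReal.toReal_one]
  linarith

section SmallBall

open scoped RealInnerProductSpace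

variable {Ω : Type*} [MeasurableSpace Ω] {P : Measure Ω} {μ : Measure ℝ}

lemma charFun_map_sum_smul {ι E : Type*} [Fintype ι] [NormedAddCommGroup E]
    [InnerProductSpace ℝ E] [MeasurableSpace E] [BorelSpace E] [SecondCountableTopology E]
    {X : ι → Ω → ℝ} (hlaw : ∀ i, HasLaw (X i) μ P) (hind : iIndepFun X P) (v : ι → E) (t : E) :
    charFun (P.map fun ω => ∑ i, X i ω • v i) t = ∏ i, charFun μ ⟪v i, t⟫ := by
  have hmeas (i : ι) : Measurable fun x : ℝ => x • v i := by fun_prop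
  have hX (i : ι) : P.map (fun ω => X i ω • v i) = μ.map fun x => x • v i := by
    rw [← (hlaw i).map_eq, AEMeasurable.map_map_of_aemeasurable (hmeas i).aemeasurable
      (hlaw i).aemeasurable]
    rfl
  rw [iIndepFun.charFun_map_fun_sum_eq_prod (X := fun i ω => X i ω • v i)
    (fun i => (hmeas i).comp_aemeasurable (hlaw i).aemeasurable) (hind.comp _ hmeas),
    Finset.prod_apply]
  refine Finset.prod_congr rfl fun i _ => ?_
  rw [hX, charFun_apply, integral_map (hmeas i).aemeasurable (by fun_prop), charFun_apply_real]
  simp only [real_inner_smul_left, Complex.ofReal_mul, mul_comm]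

lemma mul_measureReal_norm_sum_smul_le {ι E : Type*} [Fintype ι] [NormedAddCommGroup E]
    [InnerProductSpace ℝ E] [MeasurableSpace E] [BorelSpace E] [SecondCountableTopology E]
    [IsProbabilityMeasure P] {X : ι → Ω → ℝ} (hlaw : ∀ i, HasLaw (X i) μ P)
    (hind : iIndepFun X P) (v : ι → E) {ν : Measure E} [IsProbabilityMeasure ν] {c : ℝ}
    (hν : ∀ x, 0 ≤ (charFun ν x).re) (hc : ∀ x, ‖x‖ ≤ 1 → c ≤ (charFun ν x).re) :
    c * P.real {ω | ‖∑ i, X i ω • v i‖ ≤ 1} ≤ ∫ t, ∏ i, ‖charFun μ ⟪v i, t⟫‖ ∂ν := by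
  have hmeas : AEMeasurable (fun ω => ∑ i, X i ω • v i) P :=
    Finset.aemeasurable_fun_sum _ fun i _ =>
      (by fun_prop : Measurable fun x : ℝ => x • v i).comp_aemeasurable (hlaw i).aemeasurable
  have := Measure.isProbabilityMeasure_map hmeas
  have hball : P.real {ω | ‖∑ i, X i ω • v i‖ ≤ 1}
      = (P.map fun ω => ∑ i, X i ω • v i).real (Metric.closedBall 0 1) := by
    rw [map_measureReal_apply_of_aemeasurable hmeas Metric.isClosed_closedBall.measurableSet]
    simp only [Set.preimage, mem_closedBall_zero_iff]
  rw [hball]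
  refine (mul_measureReal_closedBall_le_integral_norm_charFun _ ν hν hc).trans_eq ?_
  simp only [charFun_map_sum_smul hlaw hind, norm_prod]

lemma prod_norm_charFun_inner_mul_pow_le (μ : Measure ℝ) [IsProbabilityMeasure μ] {M : ℝ} {n : ℕ}
    {z : ℂ} (hz : z ^ n = 1) (hz3 : 3 ≤ orderOf z) {u t : ℂ}
    (hut : 2 * Real.pi * (M * (‖u‖ * ‖t‖)) ≤ orderOf z) :
    ∏ j ∈ Finset.range n, ‖charFun μ ⟪u * z ^ j, t⟫‖
      ≤ Real.exp (-(gapProb μ M / (8 * Real.pi ^ 2) * n) * min ((‖u‖ * ‖t‖) ^ 2) 1) := by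
  refine (prod_norm_charFun_le_exp_neg_gapProb μ _ _ (M := M)
    (L := n / (4 * Real.pi ^ 2) * min ((‖u‖ * ‖t‖) ^ 2) 1) fun y hy => ?_).trans_eq ?_
  · have hnorm : ‖u * (y * (starRingEnd ℂ) t)‖ = |y| * (‖u‖ * ‖t‖) := by
      rw [norm_mul, norm_mul, Complex.norm_real, Complex.norm_conj, Real.norm_eq_abs]
      ring
    calc n / (4 * Real.pi ^ 2) * min ((‖u‖ * ‖t‖) ^ 2) 1
        ≤ n / (4 * Real.pi ^ 2) * min (‖u * (y * (starRingEnd ℂ) t)‖ ^ 2) 1 := by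
          rw [hnorm]
          gcongr n / (4 * Real.pi ^ 2) * min (?_ ^ 2) 1
          exact le_mul_of_one_le_left (by positivity) hy.1
      _ ≤ ∑ j ∈ Finset.range n, (1 - Real.cos (u * (y * (starRingEnd ℂ) t) * z ^ j).re) := by
          refine mul_min_norm_sq_one_le_sum_one_sub_cos hz hz3 (le_trans ?_ hut)
          rw [hnorm]
          gcongr
          exact hy.2
      _ = ∑ j ∈ Finset.range n, (1 - Real.cos (⟪u * z ^ j, t⟫ * y)) := by
          refine Finset.sum_congr rfl fun j _ => ?_
          rw [real_inner_comm, Complex.inner, ← Complex.re_mul_ofReal]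
          ring_nf
  · congr 1
    ring

lemma prod_norm_charFun_mul_pow_le (μ : Measure ℝ) [IsProbabilityMeasure μ] {M : ℝ} (n : ℕ)
    {s : ℝ} (hs : s ^ 2 = 1) {x : ℝ} (hx : M * |x| ≤ Real.pi) :
    ∏ j ∈ Finset.range n, ‖charFun μ (x * s ^ j)‖
      ≤ Real.exp (-(gapProb μ M / Real.pi ^ 2 * n) * x ^ 2) := by
  refine (prod_norm_charFun_le_exp_neg_gapProb μ _ _ (M := M)
    (L := 2 * n / Real.pi ^ 2 * x ^ 2) fun y hy => ?_).trans_eq ?_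
  · have habs (j : ℕ) : |s ^ j| = 1 := by
      rw [abs_pow, (pow_eq_one_iff_of_nonneg (abs_nonneg s) two_ne_zero).1
        ((sq_abs s).trans hs), one_pow]
    calc 2 * n / Real.pi ^ 2 * x ^ 2 = ∑ j ∈ Finset.range n, 2 / Real.pi ^ 2 * x ^ 2 := by
          rw [Finset.sum_const, Finset.card_range, nsmul_eq_mul]
          ring
      _ ≤ ∑ j ∈ Finset.range n, (1 - Real.cos (x * s ^ j * y)) := by
          refine Finset.sum_le_sum fun j _ => ?_
          have hθ : |x * s ^ j * y| = |y| * |x| := by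
            rw [abs_mul, abs_mul, habs, mul_one, mul_comm]
          have hcos := Real.cos_le_one_sub_mul_cos_sq (x := x * s ^ j * y)
            (hθ.trans_le ((mul_le_mul_of_nonneg_right hy.2 (abs_nonneg x)).trans hx))
          have hle : 2 / Real.pi ^ 2 * x ^ 2 ≤ 2 / Real.pi ^ 2 * (x * s ^ j * y) ^ 2 := by
            gcongr 2 / Real.pi ^ 2 * ?_
            rw [sq_le_sq, hθ]
            exact le_mul_of_one_le_left (abs_nonneg x) hy.1
          linarith
  · congr 1
    ring

lemma exp_neg_mul_min_le (b x : ℝ) :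
    Real.exp (-b * min x 1) ≤ Real.exp (-b * x) + Real.exp (-b) := by
  rcases min_choice x 1 with h | h <;> rw [h]
  · exact le_add_of_nonneg_right (Real.exp_pos _).le
  · rw [mul_one]
    exact le_add_of_nonneg_left (Real.exp_pos _).le

lemma integral_prod_norm_charFun_inner_mul_pow_le (μ : Measure ℝ) [IsProbabilityMeasure μ] {M : ℝ}
    (hM : 0 ≤ M) (hgap : 0 < gapProb μ M) {n : ℕ} (hn : n ≠ 0) {z : ℂ} (hz : z ^ n = 1)
    (hz3 : 3 ≤ orderOf z) {u : ℂ} (hu : u ≠ 0) (huz : 6 * Real.pi * (M * ‖u‖) ≤ orderOf z) :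
    ∫ t, ∏ j ∈ Finset.range n, ‖charFun μ ⟪u * z ^ j, t⟫‖ ∂complexTriangleMeasure
      ≤ 2 * Real.pi ^ 3 / (gapProb μ M * n * ‖u‖ ^ 2)
        + Real.exp (-(gapProb μ M / (8 * Real.pi ^ 2) * n)) := by
  set b := gapProb μ M / (8 * Real.pi ^ 2) * n with hb
  have : 0 < b := by positivity
  have hbound : ∀ᵐ t ∂complexTriangleMeasure, ∏ j ∈ Finset.range n, ‖charFun μ ⟪u * z ^ j, t⟫‖
      ≤ Real.exp (-(b * ‖u‖ ^ 2) * ‖t‖ ^ 2) + Real.exp (-b) := by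
    filter_upwards [ae_norm_le_three_complexTriangleMeasure] with t ht
    refine (prod_norm_charFun_inner_mul_pow_le μ hz hz3 (M := M) ?_).trans
      ((exp_neg_mul_min_le _ _).trans_eq ?_)
    · calc 2 * Real.pi * (M * (‖u‖ * ‖t‖)) ≤ 2 * Real.pi * (M * (‖u‖ * 3)) := by gcongr
        _ = 6 * Real.pi * (M * ‖u‖) := by ring
        _ ≤ orderOf z := huz
    · rw [← hb, mul_pow, ← mul_assoc, neg_mul]
  have hint : Integrable (fun t : ℂ => Real.exp (-(b * ‖u‖ ^ 2) * ‖t‖ ^ 2))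
      complexTriangleMeasure := by
    refine Integrable.of_bound (by fun_prop) 1 (ae_of_all _ fun t => ?_)
    rw [Real.norm_eq_abs, Real.abs_exp, Real.exp_le_one_iff, neg_mul, neg_nonpos]
    positivity
  calc ∫ t, ∏ j ∈ Finset.range n, ‖charFun μ ⟪u * z ^ j, t⟫‖ ∂complexTriangleMeasure
      ≤ ∫ t, (Real.exp (-(b * ‖u‖ ^ 2) * ‖t‖ ^ 2) + Real.exp (-b)) ∂complexTriangleMeasure :=
        integral_mono_of_nonneg (ae_of_all _ fun t => Finset.prod_nonneg fun _ _ => norm_nonneg _)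
          (hint.add (integrable_const _)) hbound
    _ = ∫ t, Real.exp (-(b * ‖u‖ ^ 2) * ‖t‖ ^ 2) ∂complexTriangleMeasure + Real.exp (-b) := by
        rw [integral_add hint (integrable_const _), integral_const, probReal_univ, one_smul]
    _ ≤ 1 / 4 * (Real.pi / (b * ‖u‖ ^ 2)) + Real.exp (-b) := by
        gcongr
        simpa [Complex.finrank_real_complex] using integral_exp_neg_mul_norm_sq_le (by norm_num)
          complexTriangleMeasure_le (a := b * ‖u‖ ^ 2) (by positivity)
    _ = _ := by
        rw [hb]
        field_simp
        ring

lemma integral_prod_norm_charFun_mul_pow_le (μ : Measure ℝ) [IsProbabilityMeasure μ] {M : ℝ}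
    (hgap : 0 < gapProb μ M) {n : ℕ} (hn : n ≠ 0) {s : ℝ} (hs : s ^ 2 = 1) {u : ℝ} (hu : 0 < u)
    (hMu : M * u ≤ 1) :
    ∫ t, ∏ j ∈ Finset.range n, ‖charFun μ ⟪u * s ^ j, t⟫‖ ∂triangleMeasure
      ≤ 1 / 2 * √(Real.pi ^ 3 / (gapProb μ M * n * u ^ 2)) := by
  set a := gapProb μ M / Real.pi ^ 2 * n * u ^ 2 with ha
  have hbound : ∀ᵐ t ∂triangleMeasure, ∏ j ∈ Finset.range n, ‖charFun μ ⟪u * s ^ j, t⟫‖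
      ≤ Real.exp (-a * ‖t‖ ^ 2) := by
    filter_upwards [ae_abs_le_two_triangleMeasure] with t ht
    have hMt : M * |u * t| ≤ Real.pi := by
      rw [abs_mul, abs_of_pos hu]
      nlinarith [Real.pi_gt_three, abs_nonneg t]
    calc ∏ j ∈ Finset.range n, ‖charFun μ ⟪u * s ^ j, t⟫‖
        = ∏ j ∈ Finset.range n, ‖charFun μ (u * t * s ^ j)‖ := by
          refine Finset.prod_congr rfl fun j _ => ?_
          rw [Real.inner_apply]
          ring_nf
      _ ≤ Real.exp (-(gapProb μ M / Real.pi ^ 2 * n) * (u * t) ^ 2) :=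
          prod_norm_charFun_mul_pow_le μ n hs hMt
      _ = Real.exp (-a * ‖t‖ ^ 2) := by
          rw [Real.norm_eq_abs, sq_abs, ha]
          ring_nf
  have hint : Integrable (fun t : ℝ => Real.exp (-a * ‖t‖ ^ 2)) triangleMeasure := by
    refine Integrable.of_bound (by fun_prop) 1 (ae_of_all _ fun t => ?_)
    rw [Real.norm_eq_abs, Real.abs_exp, Real.exp_le_one_iff, neg_mul, neg_nonpos]
    positivity
  calc ∫ t, ∏ j ∈ Finset.range n, ‖charFun μ ⟪u * s ^ j, t⟫‖ ∂triangleMeasure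
      ≤ ∫ t, Real.exp (-a * ‖t‖ ^ 2) ∂triangleMeasure :=
        integral_mono_of_nonneg (ae_of_all _ fun t => Finset.prod_nonneg fun _ _ => norm_nonneg _)
          hint hbound
    _ ≤ 1 / 2 * √(Real.pi / a) := by
        rw [Real.sqrt_eq_rpow]
        simpa using integral_exp_neg_mul_norm_sq_le (by norm_num) triangleMeasure_le (a := a)
          (by positivity)
    _ = _ := by
        rw [ha]
        field_simp

section Dft

variable [IsProbabilityMeasure P] [IsProbabilityMeasure μ] {n : ℕ} {X : Fin n → Ω → ℝ}

lemma measureReal_norm_dft_le_of_three_le_orderOf (hlaw : ∀ i, HasLaw (X i) μ P)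
    (hind : iIndepFun X P) {M : ℝ} (hM : 0 ≤ M) (hgap : 0 < gapProb μ M) (hn : n ≠ 0) {z : ℂ}
    (hz : z ^ n = 1) (hz3 : 3 ≤ orderOf z) {T : ℝ} (hT : 0 < T)
    (hTz : 6 * Real.pi * M ≤ T * orderOf z) :
    P.real {ω | ‖dft (X · ω) z‖ ≤ T} ≤ 8 * Real.pi ^ 3 * T ^ 2 / (gapProb μ M * n)
      + 4 * Real.exp (-(gapProb μ M / (8 * Real.pi ^ 2) * n)) := by
  have hscale (ω : Ω) : ∑ i, X i ω • ((T : ℂ)⁻¹ * z ^ (i : ℕ)) = (T : ℂ)⁻¹ * dft (X · ω) z := by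
    rw [dft, Finset.mul_sum]
    exact Finset.sum_congr rfl fun i _ => by rw [Complex.real_smul]; ring
  have hTnorm : ‖(T : ℂ)⁻¹‖ = T⁻¹ := by rw [norm_inv, Complex.norm_real, Real.norm_of_nonneg hT.le]
  have hesseen := mul_measureReal_norm_sum_smul_le hlaw hind
    (fun i => (T : ℂ)⁻¹ * z ^ (i : ℕ)) (ν := complexTriangleMeasure) (c := 1 / 4)
    (fun w => by rw [charFun_complexTriangleMeasure, Complex.ofReal_re]; positivity)
    fun w hw => by
      rw [charFun_complexTriangleMeasure, Complex.ofReal_re]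
      nlinarith [half_le_sinc_sq ((Complex.abs_re_le_norm w).trans hw),
        half_le_sinc_sq ((Complex.abs_im_le_norm w).trans hw)]
  have hdecay := integral_prod_norm_charFun_inner_mul_pow_le μ hM hgap hn hz hz3
    (u := (T : ℂ)⁻¹) (by simpa using hT.ne')
    (by rwa [hTnorm, ← mul_assoc, mul_inv_le_iff₀ hT, mul_comm (orderOf z : ℝ)])
  simp only [hscale, norm_mul, hTnorm, inv_mul_le_one₀ hT] at hesseen
  simp only [Finset.prod_range, hTnorm] at hdecay
  have hsimp : 4 * (2 * Real.pi ^ 3 / (gapProb μ M * n * T⁻¹ ^ 2))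
      = 8 * Real.pi ^ 3 * T ^ 2 / (gapProb μ M * n) := by
    field_simp
    norm_num
  linarith

lemma measureReal_norm_dft_le_of_sq_eq_one (hlaw : ∀ i, HasLaw (X i) μ P)
    (hind : iIndepFun X P) {M : ℝ} (hgap : 0 < gapProb μ M) (hn : n ≠ 0) {z : ℂ}
    (hz : z ^ 2 = 1) {T : ℝ} (hT : 0 < T) (hMT : M ≤ T) :
    P.real {ω | ‖dft (X · ω) z‖ ≤ T} ≤ √(Real.pi ^ 3 * T ^ 2 / (gapProb μ M * n)) := by
  obtain ⟨s, hs, rfl⟩ : ∃ s : ℝ, s ^ 2 = 1 ∧ (s : ℂ) = z := by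
    rcases sq_eq_one_iff.1 hz with rfl | rfl
    · exact ⟨1, by norm_num, by norm_num⟩
    · exact ⟨-1, by norm_num, by norm_num⟩
  have hscale (ω : Ω) : ‖∑ i, X i ω • (T⁻¹ * s ^ (i : ℕ))‖ = T⁻¹ * ‖dft (X · ω) s‖ := by
    have hdft : dft (X · ω) s = (T * ∑ i, X i ω • (T⁻¹ * s ^ (i : ℕ)) : ℝ) := by
      rw [dft, Finset.mul_sum]
      push_cast
      refine Finset.sum_congr rfl fun i _ => ?_
      have : (T : ℂ) ≠ 0 := by exact_mod_cast hT.ne'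
      simp only [smul_eq_mul]
      push_cast
      field_simp
    rw [hdft, Complex.norm_real, norm_mul, Real.norm_of_nonneg hT.le, inv_mul_cancel_left₀ hT.ne']
  have hesseen := mul_measureReal_norm_sum_smul_le hlaw hind
    (fun i => T⁻¹ * s ^ (i : ℕ)) (ν := triangleMeasure) (c := 1 / 2)
    (fun w => by rw [charFun_triangleMeasure, Complex.ofReal_re]; positivity)
    fun w hw => by
      rw [charFun_triangleMeasure, Complex.ofReal_re]
      exact half_le_sinc_sq hw
  have hdecay := integral_prod_norm_charFun_mul_pow_le μ hgap hn hs (inv_pos.2 hT)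
    (by rwa [← div_eq_mul_inv, div_le_one₀ hT])
  simp only [hscale, inv_mul_le_one₀ hT] at hesseen
  simp only [Finset.prod_range] at hdecay
  have hsimp : Real.pi ^ 3 / (gapProb μ M * n * T⁻¹ ^ 2)
      = Real.pi ^ 3 * T ^ 2 / (gapProb μ M * n) := by
    field_simp
  rw [hsimp] at hdecay
  linarith

end Dft

end SmallBall

section RootsOfUnity

open Polynomial

variable {R : Type*} [CommRing R] [IsDomain R]

lemma card_nthRootsFinset_le (n : ℕ) (a : R) : (nthRootsFinset n a).card ≤ n := by
  classical
  rw [nthRootsFinset_def]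
  exact (Multiset.toFinset_card_le _).trans (card_nthRoots n a)

lemma card_filter_pow_eq_one_le [DecidableEq R] (s : Finset R) {d : ℕ} (hd : 0 < d) :
    {z ∈ s | z ^ d = 1}.card ≤ d := by
  refine (Finset.card_le_card fun z hz => ?_).trans (card_nthRootsFinset_le d (1 : R))
  exact (mem_nthRootsFinset hd 1).2 (Finset.mem_filter.1 hz).2

lemma orderOf_mem_Icc_of_mem_nthRootsFinset {n : ℕ} {z : R} (hz : z ∈ nthRootsFinset n (1 : R)) :
    orderOf z ∈ Finset.Icc 1 n := by
  rcases Nat.eq_zero_or_pos n with rfl | hn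
  · simp at hz
  have hdvd := orderOf_dvd_of_pow_eq_one ((mem_nthRootsFinset hn 1).1 hz)
  exact Finset.mem_Icc.2 ⟨Nat.pos_of_dvd_of_pos hdvd hn, Nat.le_of_dvd hn hdvd⟩

lemma sum_nthRootsFinset_one_div_orderOf_sq_le (n : ℕ) :
    ∑ z ∈ nthRootsFinset n (1 : R), 1 / (orderOf z : ℝ) ^ 2 ≤ 1 + Real.log n := by
  classical
  have hfiber : ∀ d ∈ Finset.Icc 1 n,
      ∑ z ∈ nthRootsFinset n (1 : R) with orderOf z = d, 1 / (orderOf z : ℝ) ^ 2 ≤ (d : ℝ)⁻¹ := by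
    intro d hd
    have hd0 : 0 < d := (Finset.mem_Icc.1 hd).1
    have hcard : {z ∈ nthRootsFinset n (1 : R) | orderOf z = d}.card ≤ d := by
      refine (Finset.card_le_card (Finset.monotone_filter_right _ fun z _ hz => ?_)).trans
        (card_filter_pow_eq_one_le (nthRootsFinset n (1 : R)) hd0)
      rw [← hz, pow_orderOf_eq_one]
    calc ∑ z ∈ nthRootsFinset n (1 : R) with orderOf z = d, 1 / (orderOf z : ℝ) ^ 2
        = ∑ z ∈ nthRootsFinset n (1 : R) with orderOf z = d, 1 / (d : ℝ) ^ 2 :=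
          Finset.sum_congr rfl fun z hz => by rw [(Finset.mem_filter.1 hz).2]
      _ ≤ d * (1 / (d : ℝ) ^ 2) := by
          rw [Finset.sum_const, nsmul_eq_mul]
          gcongr
      _ = (d : ℝ)⁻¹ := by field_simp
  calc ∑ z ∈ nthRootsFinset n (1 : R), 1 / (orderOf z : ℝ) ^ 2
      = ∑ d ∈ Finset.Icc 1 n,
          ∑ z ∈ nthRootsFinset n (1 : R) with orderOf z = d, 1 / (orderOf z : ℝ) ^ 2 :=
        (Finset.sum_fiberwise_of_maps_to
          (fun z hz => orderOf_mem_Icc_of_mem_nthRootsFinset hz) _).symm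
    _ ≤ ∑ d ∈ Finset.Icc 1 n, (d : ℝ)⁻¹ := Finset.sum_le_sum hfiber
    _ ≤ 1 + Real.log n := by
        have := harmonic_le_one_add_log n
        rw [harmonic_eq_sum_Icc] at this
        push_cast at this
        exact this

end RootsOfUnity

lemma one_add_log_le_two_mul_sqrt {x : ℝ} (hx : 0 < x) : 1 + Real.log x ≤ 2 * √x := by
  have := Real.log_le_sub_one_of_pos (Real.sqrt_pos.2 hx)
  rw [Real.log_sqrt hx.le] at this
  linarith

lemma mul_exp_neg_mul_le {c x : ℝ} (hc : 0 < c) (hx : 1 ≤ x) :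
    x * Real.exp (-(c * x)) ≤ 2 / c ^ 2 * (1 / √x) := by
  have hexp : (c * x) ^ 2 / 2 ≤ Real.exp (c * x) := by
    have := Real.quadratic_le_exp_of_nonneg (x := c * x) (by positivity)
    have : 0 ≤ c * x := by positivity
    linarith
  rw [Real.exp_neg]
  calc x * (Real.exp (c * x))⁻¹ ≤ x * ((c * x) ^ 2 / 2)⁻¹ := by gcongr
    _ = 2 / c ^ 2 * (1 / x) := by field_simp
    _ ≤ 2 / c ^ 2 * (1 / √x) := by
        gcongr
        exact Real.sqrt_le_self_iff.2 (Or.inr hx)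

section SmallBallUnion

open Polynomial

variable {Ω : Type*} [MeasurableSpace Ω] {P : Measure Ω} [IsProbabilityMeasure P] {μ : Measure ℝ}
  [IsProbabilityMeasure μ] {n : ℕ} {X : Fin n → Ω → ℝ}

lemma measureReal_norm_dft_lt_le_of_sq_ne_one (hlaw : ∀ i, HasLaw (X i) μ P)
    (hind : iIndepFun X P) {M : ℝ} (hM : 0 ≤ M) (hgap : 0 < gapProb μ M) (hn : n ≠ 0) {z : ℂ}
    (hz : z ^ n = 1) (hz2 : z ^ 2 ≠ 1) {t : ℝ} (ht : 0 < t) :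
    P.real {ω | ‖dft (X · ω) z‖ < t}
      ≤ 16 * Real.pi ^ 3 / (gapProb μ M * n)
          * (t ^ 2 + (6 * Real.pi * M) ^ 2 * (1 / (orderOf z : ℝ) ^ 2))
        + 4 * Real.exp (-(gapProb μ M / (8 * Real.pi ^ 2) * n)) := by
  have hd0 : 0 < orderOf z :=
    Nat.pos_of_dvd_of_pos (orderOf_dvd_of_pow_eq_one hz) (Nat.pos_of_ne_zero hn)
  have hd3 : 3 ≤ orderOf z := by
    by_contra! hlt
    have hd : orderOf z = 1 ∨ orderOf z = 2 := by omega
    refine hz2 (orderOf_dvd_iff_pow_eq_one.1 ?_)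
    rcases hd with hd | hd <;> simp [hd]
  set d := orderOf z
  set T := t + 6 * Real.pi * M / d with hT
  have htT : t ≤ T := le_add_of_nonneg_right (by positivity)
  have hTd : 6 * Real.pi * M ≤ T * d := by
    rw [hT, add_mul, div_mul_cancel₀ _ (by positivity)]
    exact le_add_of_nonneg_left (by positivity)
  have hTsq : T ^ 2 ≤ 2 * (t ^ 2 + (6 * Real.pi * M) ^ 2 * (1 / (d : ℝ) ^ 2)) := by
    rw [mul_one_div, ← div_pow]
    exact add_sq_le
  calc P.real {ω | ‖dft (X · ω) z‖ < t} ≤ P.real {ω | ‖dft (X · ω) z‖ ≤ T} :=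
        measureReal_mono fun ω hω => (le_of_lt hω).trans htT
    _ ≤ 8 * Real.pi ^ 3 * T ^ 2 / (gapProb μ M * n)
        + 4 * Real.exp (-(gapProb μ M / (8 * Real.pi ^ 2) * n)) :=
        measureReal_norm_dft_le_of_three_le_orderOf hlaw hind hM hgap hn hz hd3
          (ht.trans_le htT) hTd
    _ ≤ 8 * Real.pi ^ 3 * (2 * (t ^ 2 + (6 * Real.pi * M) ^ 2 * (1 / (d : ℝ) ^ 2)))
          / (gapProb μ M * n) + 4 * Real.exp (-(gapProb μ M / (8 * Real.pi ^ 2) * n)) := by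
        gcongr
    _ = _ := by ring

lemma sum_measureReal_norm_dft_lt_le_of_sq_ne_one (hlaw : ∀ i, HasLaw (X i) μ P)
    (hind : iIndepFun X P) {M : ℝ} (hM : 0 ≤ M) (hgap : 0 < gapProb μ M) (hn : n ≠ 0)
    {t : ℝ} (ht : 0 < t) :
    ∑ z ∈ nthRootsFinset n (1 : ℂ) with z ^ 2 ≠ 1, P.real {ω | ‖dft (X · ω) z‖ < t}
      ≤ 16 * Real.pi ^ 3 / gapProb μ M * (t ^ 2 + 2 * (6 * Real.pi * M) ^ 2 * (1 / √n))
        + 8 / (gapProb μ M / (8 * Real.pi ^ 2)) ^ 2 * (1 / √n) := by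
  set p := gapProb μ M
  set c := p / (8 * Real.pi ^ 2)
  have hc : 0 < c := by positivity
  calc ∑ z ∈ nthRootsFinset n (1 : ℂ) with z ^ 2 ≠ 1, P.real {ω | ‖dft (X · ω) z‖ < t}
      ≤ ∑ z ∈ nthRootsFinset n (1 : ℂ) with z ^ 2 ≠ 1, (16 * Real.pi ^ 3 / (p * n)
          * (t ^ 2 + (6 * Real.pi * M) ^ 2 * (1 / (orderOf z : ℝ) ^ 2))
          + 4 * Real.exp (-(c * n))) := by
        refine Finset.sum_le_sum fun z hz => ?_
        obtain ⟨hzn, hz2⟩ := Finset.mem_filter.1 hz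
        exact measureReal_norm_dft_lt_le_of_sq_ne_one hlaw hind hM hgap hn
          ((mem_nthRootsFinset (Nat.pos_of_ne_zero hn) 1).1 hzn) hz2 ht
    _ ≤ ∑ z ∈ nthRootsFinset n (1 : ℂ), (16 * Real.pi ^ 3 / (p * n)
          * (t ^ 2 + (6 * Real.pi * M) ^ 2 * (1 / (orderOf z : ℝ) ^ 2))
          + 4 * Real.exp (-(c * n))) :=
        Finset.sum_le_sum_of_subset_of_nonneg (Finset.filter_subset _ _)
          fun z _ _ => by positivity
    _ = 16 * Real.pi ^ 3 / (p * n) * ((nthRootsFinset n (1 : ℂ)).card * t ^ 2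
          + (6 * Real.pi * M) ^ 2 * ∑ z ∈ nthRootsFinset n (1 : ℂ), 1 / (orderOf z : ℝ) ^ 2)
          + 4 * ((nthRootsFinset n (1 : ℂ)).card * Real.exp (-(c * n))) := by
        simp only [Finset.sum_add_distrib, ← Finset.mul_sum, Finset.sum_const, nsmul_eq_mul]
    _ ≤ 16 * Real.pi ^ 3 / (p * n) * (n * t ^ 2 + (6 * Real.pi * M) ^ 2 * (2 * √n))
          + 4 * (2 / c ^ 2 * (1 / √n)) := by
        have hcard : ((nthRootsFinset n (1 : ℂ)).card : ℝ) ≤ n := by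
          exact_mod_cast card_nthRootsFinset_le n (1 : ℂ)
        have hexp : (nthRootsFinset n (1 : ℂ)).card * Real.exp (-(c * n)) ≤ 2 / c ^ 2 * (1 / √n) :=
          (mul_le_mul_of_nonneg_right hcard (Real.exp_pos _).le).trans
            (mul_exp_neg_mul_le hc (Nat.one_le_cast.2 (Nat.pos_of_ne_zero hn)))
        have hsum := (sum_nthRootsFinset_one_div_orderOf_sq_le (R := ℂ) n).trans
          (one_add_log_le_two_mul_sqrt (by positivity))
        gcongr
    _ = _ := by
        rw [← Real.sqrt_div_self']
        field_simp
        ring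

lemma sum_measureReal_norm_dft_lt_le_of_sq_eq_one (hlaw : ∀ i, HasLaw (X i) μ P)
    (hind : iIndepFun X P) {M : ℝ} (hM : 0 ≤ M) (hgap : 0 < gapProb μ M) (hn : n ≠ 0)
    {t : ℝ} (ht : t ≤ 1) :
    ∑ z ∈ nthRootsFinset n (1 : ℂ) with z ^ 2 = 1, P.real {ω | ‖dft (X · ω) z‖ < t}
      ≤ 2 * √(Real.pi ^ 3 * (M + 1) ^ 2 / gapProb μ M) * (1 / √n) := by
  calc ∑ z ∈ nthRootsFinset n (1 : ℂ) with z ^ 2 = 1, P.real {ω | ‖dft (X · ω) z‖ < t}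
      ≤ ∑ z ∈ nthRootsFinset n (1 : ℂ) with z ^ 2 = 1,
          √(Real.pi ^ 3 * (M + 1) ^ 2 / (gapProb μ M * n)) := by
        refine Finset.sum_le_sum fun z hz => ?_
        have hsub : {ω | ‖dft (X · ω) z‖ < t} ⊆ {ω | ‖dft (X · ω) z‖ ≤ M + 1} := by
          intro ω hω
          rw [Set.mem_ofPred_eq] at hω ⊢
          linarith
        exact (measureReal_mono hsub).trans (measureReal_norm_dft_le_of_sq_eq_one hlaw hind hgap hn
          (Finset.mem_filter.1 hz).2 (by positivity) (by linarith))
    _ ≤ 2 * √(Real.pi ^ 3 * (M + 1) ^ 2 / (gapProb μ M * n)) := by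
        rw [Finset.sum_const, nsmul_eq_mul]
        gcongr
        exact_mod_cast card_filter_pow_eq_one_le (nthRootsFinset n (1 : ℂ)) two_pos
    _ = _ := by
        rw [← div_div, Real.sqrt_div (by positivity) (n : ℝ)]
        ring

end SmallBallUnion

open Polynomial in
lemma exists_measureReal_exists_norm_dft_lt_le {μ : Measure ℝ} [IsProbabilityMeasure μ]
    (hH : ConditionH μ) :
    ∃ C : ℝ, 0 < C ∧ ∀ (Ω : Type*) [MeasurableSpace Ω] (P : Measure Ω) [IsProbabilityMeasure P]
      (n : ℕ) (X : Fin n → Ω → ℝ), (∀ i, HasLaw (X i) μ P) → iIndepFun X P → n ≠ 0 →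
        ∀ t : ℝ, 0 < t → P.real {ω | ∃ z ∈ nthRootsFinset n (1 : ℂ), ‖dft (X · ω) z‖ < t}
          ≤ C * (t ^ 2 + 1 / √n) := by
  obtain ⟨M, hM, hgap⟩ := hH.exists_gapProb_pos
  set A := 16 * Real.pi ^ 3 / gapProb μ M
  set B := 2 * A * (6 * Real.pi * M) ^ 2 + 8 / (gapProb μ M / (8 * Real.pi ^ 2)) ^ 2
    + 2 * √(Real.pi ^ 3 * (M + 1) ^ 2 / gapProb μ M) with hB
  have hA0 : 0 < A := by positivity
  have hB0 : 0 < B := by positivity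
  refine ⟨1 + A + B, by positivity, fun Ω _ P _ n X hlaw hind hn t ht => ?_⟩
  have hr : 0 < 1 / √(n : ℝ) := by positivity
  set r := 1 / √(n : ℝ)
  rcases le_or_gt t 1 with ht1 | ht1
  swap
  · refine measureReal_le_one.trans ?_
    nlinarith
  have hunion : {ω | ∃ z ∈ nthRootsFinset n (1 : ℂ), ‖dft (X · ω) z‖ < t}
      = ⋃ z ∈ nthRootsFinset n (1 : ℂ), {ω | ‖dft (X · ω) z‖ < t} := by
    ext ω
    simp
  calc P.real {ω | ∃ z ∈ nthRootsFinset n (1 : ℂ), ‖dft (X · ω) z‖ < t}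
      ≤ ∑ z ∈ nthRootsFinset n (1 : ℂ), P.real {ω | ‖dft (X · ω) z‖ < t} := by
        rw [hunion]
        exact measureReal_biUnion_finset_le _ _
    _ = ∑ z ∈ nthRootsFinset n (1 : ℂ) with z ^ 2 = 1, P.real {ω | ‖dft (X · ω) z‖ < t}
        + ∑ z ∈ nthRootsFinset n (1 : ℂ) with z ^ 2 ≠ 1, P.real {ω | ‖dft (X · ω) z‖ < t} :=
        (Finset.sum_filter_add_sum_filter_not _ _ _).symm
    _ ≤ A * t ^ 2 + B * r := by
        have hreal := sum_measureReal_norm_dft_lt_le_of_sq_eq_one hlaw hind hM.le hgap hn ht1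
        have hcomplex := sum_measureReal_norm_dft_lt_le_of_sq_ne_one hlaw hind hM.le hgap hn ht
        rw [hB]
        linarith
    _ ≤ (1 + A + B) * (t ^ 2 + r) := by
        nlinarith [sq_nonneg t, mul_nonneg hA0.le hr.le, mul_nonneg hB0.le (sq_nonneg t)]

section ExponentialMoments

lemma exp_le_one_add_add_sq_mul_exp_abs (y : ℝ) :
    Real.exp y ≤ 1 + y + y ^ 2 * Real.exp |y| := by
  have hexp : 1 ≤ Real.exp |y| := Real.one_le_exp (abs_nonneg y)
  rcases le_or_gt |y| 1 with h | h
  · have htaylor := (abs_le.1 (Real.abs_exp_sub_one_sub_id_le h)).2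
    nlinarith [sq_nonneg y]
  · have hsq : 1 ≤ y ^ 2 := by
      rw [← sq_abs]
      exact one_le_pow₀ h.le
    rcases le_total 0 y with hy | hy
    · rw [abs_of_nonneg hy] at hexp ⊢
      nlinarith
    · have hle : Real.exp y ≤ 1 := Real.exp_le_one_iff.2 hy
      have hlinear := Real.add_one_le_exp |y|
      rw [abs_of_nonpos hy] at hexp hlinear ⊢
      nlinarith

/-- The moment generating function of `X` exists and is at most `exp b` on `[-s, s]`. This is the
hypothesis of the Chernoff bound, in the form stable under independent sums. -/
structure HasMGFBound {Ω : Type*} [MeasurableSpace Ω] (X : Ω → ℝ) (P : Measure Ω)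
    (s b : ℝ) : Prop where
  integrable_exp_mul : ∀ t, |t| ≤ s → Integrable (fun ω => Real.exp (t * X ω)) P
  mgf_le : ∀ t, |t| ≤ s → mgf X P t ≤ Real.exp b

namespace HasMGFBound

variable {Ω : Type*} [MeasurableSpace Ω] {P : Measure Ω} {s b : ℝ}

lemma of_integral_sq_mul_exp_le [IsProbabilityMeasure P] {X : Ω → ℝ} {a m B : ℝ}
    (hs : 0 ≤ s) (hsa : s ≤ a) (hX : Integrable X P) (hmean : |∫ ω, X ω ∂P| ≤ m)
    (hint : Integrable (fun ω => X ω ^ 2 * Real.exp (a * |X ω|)) P)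
    (hB : ∫ ω, X ω ^ 2 * Real.exp (a * |X ω|) ∂P ≤ B) :
    HasMGFBound X P s (s * m + s ^ 2 * B) := by
  have hpointwise {t : ℝ} (ht : |t| ≤ s) (ω : Ω) : Real.exp (t * X ω) ≤
      1 + t * X ω + s ^ 2 * (X ω ^ 2 * Real.exp (a * |X ω|)) := by
    have hsq : (t * X ω) ^ 2 * Real.exp |t * X ω| ≤
        s ^ 2 * (X ω ^ 2 * Real.exp (a * |X ω|)) := by
      rw [mul_pow, mul_assoc, abs_mul, ← sq_abs t]
      gcongr
      exact ht.trans hsa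
    linarith [exp_le_one_add_add_sq_mul_exp_abs (t * X ω)]
  have hlinear (t : ℝ) : Integrable (fun ω => 1 + t * X ω) P :=
    (integrable_const 1).add (hX.const_mul t)
  have hmajorant (t : ℝ) :
      Integrable (fun ω => 1 + t * X ω + s ^ 2 * (X ω ^ 2 * Real.exp (a * |X ω|))) P :=
    (hlinear t).add (hint.const_mul _)
  have hexp {t : ℝ} (ht : |t| ≤ s) : Integrable (fun ω => Real.exp (t * X ω)) P :=
    (hmajorant t).mono' (hX.aemeasurable.const_mul t).exp.aestronglyMeasurable
      (ae_of_all _ fun ω => by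
        rw [Real.norm_eq_abs, Real.abs_exp]
        exact hpointwise ht ω)
  refine ⟨fun t ht => hexp ht, fun t ht => ?_⟩
  have htmean : t * ∫ ω, X ω ∂P ≤ s * m :=
    calc t * ∫ ω, X ω ∂P ≤ |t| * |∫ ω, X ω ∂P| := (le_abs_self _).trans (abs_mul _ _).le
      _ ≤ s * m := by gcongr
  calc mgf X P t
      ≤ ∫ ω, (1 + t * X ω + s ^ 2 * (X ω ^ 2 * Real.exp (a * |X ω|))) ∂P :=
        integral_mono (hexp ht) (hmajorant t) (hpointwise ht)
    _ = 1 + t * ∫ ω, X ω ∂P + s ^ 2 * ∫ ω, X ω ^ 2 * Real.exp (a * |X ω|) ∂P := by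
        rw [integral_add (hlinear t) (hint.const_mul _),
          integral_add (integrable_const 1) (hX.const_mul t), integral_const_mul,
          integral_const_mul, integral_const, probReal_univ, one_smul]
    _ ≤ s * m + s ^ 2 * B + 1 := by linarith [mul_le_mul_of_nonneg_left hB (sq_nonneg s)]
    _ ≤ Real.exp (s * m + s ^ 2 * B) := Real.add_one_le_exp _

lemma aemeasurable {X : Ω → ℝ} (h : HasMGFBound X P s b) (hs : 0 < s) : AEMeasurable X P :=
  Real.aemeasurable_of_aemeasurable_exp_mul hs.ne'
    (h.integrable_exp_mul s (abs_of_pos hs).le).aemeasurable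

lemma const_mul {X : Ω → ℝ} (h : HasMGFBound X P s b) {c : ℝ} (hc : |c| ≤ 1) :
    HasMGFBound (fun ω => c * X ω) P s b := by
  have hbound {t : ℝ} (ht : |t| ≤ s) : |t * c| ≤ s := by
    rw [abs_mul]
    exact (mul_le_of_le_one_right (abs_nonneg t) hc).trans ht
  refine ⟨fun t ht => ?_, fun t ht => ?_⟩
  · simpa only [mul_assoc] using h.integrable_exp_mul _ (hbound ht)
  · rw [mgf_const_mul, mul_comm]
    exact h.mgf_le _ (hbound ht)

lemma sum {ι : Type*} [Fintype ι] {X : ι → Ω → ℝ} (hs : 0 < s)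
    (hind : iIndepFun X P) (h : ∀ i, HasMGFBound (X i) P s b) :
    HasMGFBound (∑ i, X i) P s (Fintype.card ι * b) := by
  have := hind.isProbabilityMeasure
  have hprod (t : ℝ) : mgf (∑ i, X i) P t = ∏ i, mgf (X i) P t :=
    hind.mgf_sum₀ (fun i => (h i).aemeasurable hs) _
  refine ⟨fun t ht => Integrable.of_integral_ne_zero ?_, fun t ht => ?_⟩
  · exact ((hprod t).trans_gt (Finset.prod_pos fun i _ =>
      mgf_pos ((h i).integrable_exp_mul t ht))).ne'
  · calc mgf (∑ i, X i) P t = ∏ i, mgf (X i) P t := hprod t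
      _ ≤ ∏ _i : ι, Real.exp b :=
        Finset.prod_le_prod (fun i _ => mgf_nonneg) fun i _ => (h i).mgf_le t ht
      _ = Real.exp (Fintype.card ι * b) := by
        rw [Finset.prod_const, Finset.card_univ, Real.exp_nat_mul]

lemma measureReal_le_abs_le [IsFiniteMeasure P] {X : Ω → ℝ} (h : HasMGFBound X P s b)
    (hs : 0 ≤ s) (r : ℝ) : P.real {ω | r ≤ |X ω|} ≤ 2 * Real.exp (b - s * r) := by
  have hupper : P.real {ω | r ≤ X ω} ≤ Real.exp (b - s * r) :=
    calc P.real {ω | r ≤ X ω} ≤ Real.exp (-s * r) * mgf X P s :=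
        measure_ge_le_exp_mul_mgf r hs (h.integrable_exp_mul s (abs_of_nonneg hs).le)
      _ ≤ Real.exp (-s * r) * Real.exp b := by
        gcongr
        exact h.mgf_le s (abs_of_nonneg hs).le
      _ = Real.exp (b - s * r) := by rw [← Real.exp_add]; ring_nf
  have hneg : |-s| ≤ s := by rw [abs_neg, abs_of_nonneg hs]
  have hlower : P.real {ω | X ω ≤ -r} ≤ Real.exp (b - s * r) :=
    calc P.real {ω | X ω ≤ -r} ≤ Real.exp (-(-s) * -r) * mgf X P (-s) :=
        measure_le_le_exp_mul_mgf (-r) (neg_nonpos.2 hs) (h.integrable_exp_mul _ hneg)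
      _ ≤ Real.exp (-(-s) * -r) * Real.exp b := by
        gcongr
        exact h.mgf_le _ hneg
      _ = Real.exp (b - s * r) := by rw [← Real.exp_add]; ring_nf
  calc P.real {ω | r ≤ |X ω|} ≤ P.real ({ω | r ≤ X ω} ∪ {ω | X ω ≤ -r}) := by
        refine measureReal_mono fun ω (hω : r ≤ |X ω|) => ?_
        exact (le_abs.1 hω).imp id fun h => (le_neg_of_le_neg h : X ω ≤ -r)
    _ ≤ P.real {ω | r ≤ X ω} + P.real {ω | X ω ≤ -r} := measureReal_union_le _ _
    _ ≤ 2 * Real.exp (b - s * r) := by linarith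

variable {n : ℕ} {X : Fin n → Ω → ℝ}

lemma measureReal_lt_norm_dft_le (hs : 0 < s) (hind : iIndepFun X P)
    (h : ∀ i, HasMGFBound (X i) P s b) {z : ℂ} (hz : ‖z‖ = 1) (r : ℝ) :
    P.real {ω | 2 * r < ‖dft (X · ω) z‖} ≤ 4 * Real.exp (n * b - s * r) := by
  have := hind.isProbabilityMeasure
  have hprojection {c : Fin n → ℝ} (hc : ∀ i, |c i| ≤ 1) :
      P.real {ω | r ≤ |∑ i, c i * X i ω|} ≤ 2 * Real.exp (n * b - s * r) := by
    have hsum := sum hs (hind.comp (fun i x => c i * x) fun i => measurable_const_mul (c i))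
      fun i => (h i).const_mul (hc i)
    simpa using hsum.measureReal_le_abs_le hs.le r
  have hpow (i : ℕ) : ‖z ^ i‖ = 1 := by rw [norm_pow, hz, one_pow]
  have hre (ω : Ω) : (dft (X · ω) z).re = ∑ i : Fin n, (z ^ (i : ℕ)).re * X i ω := by
    simp [dft, mul_comm]
  have him (ω : Ω) : (dft (X · ω) z).im = ∑ i : Fin n, (z ^ (i : ℕ)).im * X i ω := by
    simp [dft, mul_comm]
  calc P.real {ω | 2 * r < ‖dft (X · ω) z‖}
      ≤ P.real ({ω | r ≤ |(dft (X · ω) z).re|} ∪ {ω | r ≤ |(dft (X · ω) z).im|}) := by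
        refine measureReal_mono fun ω hω => ?_
        rw [Set.mem_ofPred_eq] at hω
        by_contra! hsmall
        simp only [Set.mem_union, Set.mem_ofPred_eq, not_or, not_le] at hsmall
        linarith [Complex.norm_le_abs_re_add_abs_im (dft (X · ω) z)]
    _ ≤ P.real {ω | r ≤ |(dft (X · ω) z).re|} + P.real {ω | r ≤ |(dft (X · ω) z).im|} :=
        measureReal_union_le _ _
    _ ≤ 2 * Real.exp (n * b - s * r) + 2 * Real.exp (n * b - s * r) := by
        simp only [hre, him]
        exact add_le_add
          (hprojection fun i => (Complex.abs_re_le_norm _).trans (hpow i).le)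
          (hprojection fun i => (Complex.abs_im_le_norm _).trans (hpow i).le)
    _ = 4 * Real.exp (n * b - s * r) := by ring

open Polynomial in
lemma measureReal_exists_lt_norm_dft_le (hs : 0 < s) (hind : iIndepFun X P)
    (h : ∀ i, HasMGFBound (X i) P s b) (r : ℝ) :
    P.real {ω | ∃ z ∈ nthRootsFinset n (1 : ℂ), 2 * r < ‖dft (X · ω) z‖} ≤
      n * (4 * Real.exp (n * b - s * r)) := by
  rcases n.eq_zero_or_pos with rfl | hn
  · simp
  have hunion : {ω | ∃ z ∈ nthRootsFinset n (1 : ℂ), 2 * r < ‖dft (X · ω) z‖}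
      = ⋃ z ∈ nthRootsFinset n (1 : ℂ), {ω | 2 * r < ‖dft (X · ω) z‖} := by
    ext ω
    simp
  calc P.real {ω | ∃ z ∈ nthRootsFinset n (1 : ℂ), 2 * r < ‖dft (X · ω) z‖}
      ≤ ∑ z ∈ nthRootsFinset n (1 : ℂ), P.real {ω | 2 * r < ‖dft (X · ω) z‖} := by
        rw [hunion]
        exact measureReal_biUnion_finset_le _ _
    _ ≤ ∑ _z ∈ nthRootsFinset n (1 : ℂ), 4 * Real.exp (n * b - s * r) := by
        refine Finset.sum_le_sum fun z hz => measureReal_lt_norm_dft_le hs hind h ?_ r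
        exact Complex.norm_eq_one_of_pow_eq_one ((mem_nthRootsFinset hn 1).1 hz) hn.ne'
    _ ≤ n * (4 * Real.exp (n * b - s * r)) := by
        rw [Finset.sum_const, nsmul_eq_mul]
        gcongr
        exact card_nthRootsFinset_le n 1

end HasMGFBound

end ExponentialMoments

section UpperTail

open Polynomial

variable {Ω : Type*} [MeasurableSpace Ω] {P : Measure Ω}

lemma measureReal_exists_lt_norm_dft_le_of_integral_sq_mul_exp_le {n : ℕ} {X : Fin n → Ω → ℝ}
    {a B : ℝ} (hind : iIndepFun X P) (hX : ∀ i, Integrable (X i) P)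
    (hmean : ∀ i, ∫ ω, X i ω ∂P = 0)
    (hint : ∀ i, Integrable (fun ω => X i ω ^ 2 * Real.exp (a * |X i ω|)) P)
    (hB : ∀ i, ∫ ω, X i ω ^ 2 * Real.exp (a * |X i ω|) ∂P ≤ B) (hn : 1 < n)
    (hna : √(Real.log n / n) ≤ a) :
    P.real {ω | ∃ z ∈ nthRootsFinset n (1 : ℂ),
      2 * ((B + 2) * (√n * √(Real.log n))) < ‖dft (X · ω) z‖} ≤ 4 / n := by
  have := hind.isProbabilityMeasure
  have hn₀ : (0 : ℝ) < n := by positivity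
  have hlog : 0 < Real.log n := Real.log_pos (by exact_mod_cast hn)
  have hs : 0 < √(Real.log n / n) := by positivity
  have hbound (i : Fin n) := HasMGFBound.of_integral_sq_mul_exp_le hs.le hna (hX i)
    (abs_nonpos_iff.2 (hmean i)) (hint i) (hB i)
  have hexponent : n * (√(Real.log n / n) * 0 + √(Real.log n / n) ^ 2 * B)
      - √(Real.log n / n) * ((B + 2) * (√n * √(Real.log n))) = -(Real.log n + Real.log n) := by
    have hproduct : √(Real.log n / n) * (√n * √(Real.log n)) = Real.log n := by
      rw [← mul_assoc, ← Real.sqrt_mul (by positivity), div_mul_cancel₀ _ hn₀.ne',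
        Real.mul_self_sqrt hlog.le]
    rw [mul_left_comm _ (B + 2), hproduct, Real.sq_sqrt (by positivity)]
    field_simp
    ring
  refine (HasMGFBound.measureReal_exists_lt_norm_dft_le hs hind hbound _).trans_eq ?_
  rw [hexponent, Real.exp_neg, Real.exp_add, Real.exp_log hn₀]
  field_simp

lemma integrable_comp_of_hasLaw {α E : Type*} [MeasurableSpace α] [NormedAddCommGroup E]
    {μ : Measure α} {X : Ω → α} {f : α → E} (hX : HasLaw X μ P) (hf : Integrable f μ) :
    Integrable (fun ω => f (X ω)) P := by
  rw [← hX.map_eq] at hf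
  exact hf.comp_aemeasurable hX.aemeasurable

lemma HasMGFNearZero.exists_integrable_sq_mul_exp {μ : Measure ℝ} (h : HasMGFNearZero μ) :
    ∃ a : ℝ, 0 < a ∧ Integrable (fun x : ℝ => x ^ 2 * Real.exp (a * |x|)) μ := by
  obtain ⟨a, ha, hexp⟩ := h
  refine ⟨a / 4, by positivity, ?_⟩
  have hint := integrable_pow_abs_mul_exp_add_of_integrable_exp_mul (X := fun x : ℝ => x) (μ := μ)
    (v := 0) (t := a / 2) (x := a / 4)
    (by simpa using hexp (a / 2) ⟨by linarith, by linarith⟩)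
    (by simpa using hexp (-(a / 2)) ⟨by linarith, by linarith⟩) (by positivity)
    (by rw [abs_of_pos (by positivity)]; linarith) 2
  simpa using hint

lemma HasMGFNearZero.integrable_id {μ : Measure ℝ} (h : HasMGFNearZero μ) :
    Integrable (fun x : ℝ => x) μ := by
  obtain ⟨a, ha, hexp⟩ := h
  have hint := integrable_pow_of_integrable_exp_mul (X := fun x : ℝ => x) (μ := μ) (t := a / 2)
    (by positivity) (hexp (a / 2) ⟨by linarith, by linarith⟩)
    (hexp (-(a / 2)) ⟨by linarith, by linarith⟩) 1
  simpa using hint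

lemma tendsto_sqrt_log_div_atTop :
    Tendsto (fun n : ℕ => √(Real.log n / n)) atTop (𝓝 0) := by
  have hdiv : Tendsto (fun x : ℝ => Real.log x / x) atTop (𝓝 0) := by
    simpa using Real.isLittleO_log_id_atTop.tendsto_div_nhds_zero
  simpa using (hdiv.comp tendsto_natCast_atTop_atTop).sqrt

lemma HasMGFNearZero.exists_measureReal_exists_lt_norm_dft_le {μ : Measure ℝ}
    (hmgf : HasMGFNearZero μ) (hmean : ∫ x, x ∂μ = 0) :
    ∃ A : ℝ, 0 < A ∧ ∀ᶠ n : ℕ in atTop, ∀ (Ω : Type*) [MeasurableSpace Ω] (P : Measure Ω)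
      (X : Fin n → Ω → ℝ), (∀ i, HasLaw (X i) μ P) → iIndepFun X P →
        P.real {ω | ∃ z ∈ nthRootsFinset n (1 : ℂ), A * (√n * √(Real.log n)) < ‖dft (X · ω) z‖}
          ≤ 4 / n := by
  obtain ⟨a, ha, hint⟩ := hmgf.exists_integrable_sq_mul_exp
  have : 0 ≤ ∫ x, x ^ 2 * Real.exp (a * |x|) ∂μ := integral_nonneg fun x => by positivity
  refine ⟨2 * ((∫ x, x ^ 2 * Real.exp (a * |x|) ∂μ) + 2), by positivity, ?_⟩
  filter_upwards [tendsto_sqrt_log_div_atTop.eventually_le_const ha, eventually_gt_atTop 1]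
    with n hna hn Ω _ P X hlaw hind
  simp only [mul_assoc]
  refine measureReal_exists_lt_norm_dft_le_of_integral_sq_mul_exp_le hind (fun i => ?_)
    (fun i => ?_) (fun i => ?_) (fun i => ?_) hn hna
  · exact integrable_comp_of_hasLaw (f := fun x : ℝ => x) (hlaw i) hmgf.integrable_id
  · exact (hlaw i).integral_eq.trans hmean
  · exact integrable_comp_of_hasLaw (hlaw i) hint
  · exact ((hlaw i).integral_comp (f := fun x : ℝ => x ^ 2 * Real.exp (a * |x|))
      (by fun_prop)).le

section Truncation

lemma abs_sub_truncation_le {α : Type*} {R : ℝ} (hR : 0 < R) (f : α → ℝ) (x : α) :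
    |f x - truncation f R x| ≤ f x ^ 2 / R := by
  rcases lt_or_ge |f x| R with h | h
  · rw [truncation_eq_self h, sub_self, abs_zero]
    positivity
  · have hself : |f x - truncation f R x| ≤ |f x| := by
      simp only [truncation, Function.comp_apply, Set.indicator, id]
      split_ifs <;> simp
    rw [le_div_iff₀ hR, ← sq_abs, sq]
    exact mul_le_mul hself h hR.le (abs_nonneg _)

variable {X : Ω → ℝ} {R : ℝ}

lemma truncation_sq_mul_exp_le {α : Type*} {s : ℝ} (hs : 0 ≤ s) (hR : 0 ≤ R) (f : α → ℝ)
    (x : α) :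
    truncation f R x ^ 2 * Real.exp (s * |truncation f R x|) ≤ f x ^ 2 * Real.exp (s * R) := by
  have hbound : |truncation f R x| ≤ R :=
    (abs_truncation_le_bound f R x).trans_eq (abs_of_nonneg hR)
  have hsq : truncation f R x ^ 2 ≤ f x ^ 2 := sq_le_sq.2 (abs_truncation_le_abs_self f R x)
  gcongr

lemma integrable_truncation_sq_mul_exp {s : ℝ} (hX : MemLp X 2 P) (hs : 0 ≤ s) (hR : 0 ≤ R) :
    Integrable (fun ω => truncation X R ω ^ 2 * Real.exp (s * |truncation X R ω|)) P := by
  have := hX.aestronglyMeasurable.truncation (A := R)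
  refine (hX.integrable_sq.mul_const (Real.exp (s * R))).mono' (by fun_prop)
    (ae_of_all _ fun ω => ?_)
  rw [Real.norm_of_nonneg (by positivity)]
  exact truncation_sq_mul_exp_le hs hR X ω

lemma integral_truncation_sq_mul_exp_le {s : ℝ} (hX : MemLp X 2 P) (hs : 0 ≤ s) (hR : 0 ≤ R) :
    ∫ ω, truncation X R ω ^ 2 * Real.exp (s * |truncation X R ω|) ∂P ≤
      (∫ ω, X ω ^ 2 ∂P) * Real.exp (s * R) := by
  rw [← integral_mul_const]
  exact integral_mono (integrable_truncation_sq_mul_exp hX hs hR) (hX.integrable_sq.mul_const _)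
    (truncation_sq_mul_exp_le hs hR X)

variable [IsFiniteMeasure P]

lemma integral_abs_sub_truncation_le (hX : MemLp X 2 P) (hR : 0 < R) :
    ∫ ω, |X ω - truncation X R ω| ∂P ≤ (∫ ω, X ω ^ 2 ∂P) / R := by
  rw [← integral_div]
  exact integral_mono
    ((hX.integrable one_le_two).sub hX.aestronglyMeasurable.integrable_truncation).abs
    (hX.integrable_sq.div_const R) (abs_sub_truncation_le hR X)

lemma abs_integral_truncation_le (hX : MemLp X 2 P) (hmean : ∫ ω, X ω ∂P = 0) (hR : 0 < R) :
    |∫ ω, truncation X R ω ∂P| ≤ (∫ ω, X ω ^ 2 ∂P) / R := by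
  have hsub : ∫ ω, (X ω - truncation X R ω) ∂P = -∫ ω, truncation X R ω ∂P := by
    rw [integral_sub (hX.integrable one_le_two) hX.aestronglyMeasurable.integrable_truncation,
      hmean, zero_sub]
  rw [← abs_neg, ← hsub]
  exact abs_integral_le_integral_abs.trans (integral_abs_sub_truncation_le hX hR)

end Truncation

lemma hasMGFBound_truncation [IsProbabilityMeasure P] {X : Ω → ℝ} {R V c : ℝ} (hX : MemLp X 2 P)
    (hmean : ∫ ω, X ω ∂P = 0) (hV : ∫ ω, X ω ^ 2 ∂P ≤ V) (hR : 0 < R) (hc : 0 ≤ c) :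
    HasMGFBound (truncation X R) P (c / R) ((c * V + c ^ 2 * (V * Real.exp c)) / R ^ 2) := by
  have hs : 0 ≤ c / R := by positivity
  have hsecond : ∫ ω, truncation X R ω ^ 2 * Real.exp (c / R * |truncation X R ω|) ∂P ≤
      V * Real.exp c :=
    calc _ ≤ (∫ ω, X ω ^ 2 ∂P) * Real.exp (c / R * R) :=
          integral_truncation_sq_mul_exp_le hX hs hR.le
      _ ≤ V * Real.exp c := by
        rw [div_mul_cancel₀ c hR.ne']
        gcongr
  convert HasMGFBound.of_integral_sq_mul_exp_le hs le_rfl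
    hX.aestronglyMeasurable.integrable_truncation
    ((abs_integral_truncation_le hX hmean hR).trans (div_le_div_of_nonneg_right hV hR.le))
    (integrable_truncation_sq_mul_exp hX hs hR.le) hsecond using 1
  field_simp

section SecondMoment

lemma norm_dft_le {n : ℕ} (v : Fin n → ℝ) {z : ℂ} (hz : ‖z‖ = 1) : ‖dft v z‖ ≤ ∑ i, |v i| :=
  (norm_sum_le _ _).trans_eq (Finset.sum_congr rfl fun i _ => by simp [hz])

lemma norm_dft_sub_le {n : ℕ} (v w : Fin n → ℝ) {z : ℂ} (hz : ‖z‖ = 1) :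
    ‖dft v z‖ ≤ ‖dft w z‖ + ∑ i, |v i - w i| := by
  have hsub : dft v z - dft w z = dft (v - w) z := by
    simp [dft, sub_mul, Finset.sum_sub_distrib]
  calc ‖dft v z‖ = ‖dft w z + dft (v - w) z‖ := by rw [← hsub, add_sub_cancel]
    _ ≤ ‖dft w z‖ + ‖dft (v - w) z‖ := norm_add_le _ _
    _ ≤ ‖dft w z‖ + ∑ i, |v i - w i| := by
      gcongr
      exact norm_dft_le (v - w) hz

variable {n : ℕ} {X : Fin n → Ω → ℝ} {V : ℝ}

lemma measureReal_exists_lt_norm_dft_truncation_le (hind : iIndepFun X P)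
    (hX : ∀ i, MemLp (X i) 2 P) (hmean : ∀ i, ∫ ω, X i ω ∂P = 0)
    (hV : ∀ i, ∫ ω, X i ω ^ 2 ∂P ≤ V) (hn : n ≠ 0) :
    P.real {ω | ∃ z ∈ nthRootsFinset n (1 : ℂ),
      2 * (√n * Real.log n) < ‖dft (fun i => truncation (X i) √n ω) z‖} ≤
        4 * Real.exp (3 * V + 9 * (V * Real.exp 3)) / n ^ 2 := by
  have := hind.isProbabilityMeasure
  have hn₀ : (0 : ℝ) < n := by positivity
  have hR : 0 < √(n : ℝ) := by positivity
  have hbound (i : Fin n) := hasMGFBound_truncation (hX i) (hmean i) (hV i) hR zero_le_three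
  have hind_truncation : iIndepFun (fun i => truncation (X i) √n) P :=
    hind.comp (fun _ => (Set.Ioc (-√(n : ℝ)) √n).indicator id)
      fun _ => measurable_id.indicator measurableSet_Ioc
  have hexponent : n * ((3 * V + 3 ^ 2 * (V * Real.exp 3)) / √(n : ℝ) ^ 2)
      - 3 / √n * (√n * Real.log n) =
        3 * V + 9 * (V * Real.exp 3) - (3 : ℕ) * Real.log n := by
    rw [Real.sq_sqrt hn₀.le]
    field_simp
    ring
  refine (HasMGFBound.measureReal_exists_lt_norm_dft_le (by positivity) hind_truncation hbound
    _).trans_eq ?_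
  rw [hexponent, Real.exp_sub, Real.exp_nat_mul, Real.exp_log hn₀]
  field_simp

lemma mul_measureReal_le_sum_abs_sub_truncation_le [IsFiniteMeasure P]
    (hX : ∀ i, MemLp (X i) 2 P) (hV : ∀ i, ∫ ω, X i ω ^ 2 ∂P ≤ V) (hn : n ≠ 0) (r : ℝ) :
    r * P.real {ω | √n * r ≤ ∑ i, |X i ω - truncation (X i) √n ω|} ≤ V := by
  have hR : 0 < √(n : ℝ) := by positivity
  have hint (i : Fin n) : Integrable (fun ω => |X i ω - truncation (X i) √n ω|) P :=
    (((hX i).integrable one_le_two).sub (hX i).aestronglyMeasurable.integrable_truncation).abs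
  refine le_of_mul_le_mul_left ?_ hR
  calc √n * (r * P.real {ω | √n * r ≤ ∑ i, |X i ω - truncation (X i) √n ω|})
      ≤ ∫ ω, ∑ i, |X i ω - truncation (X i) √n ω| ∂P := by
        rw [← mul_assoc]
        exact mul_meas_ge_le_integral_of_nonneg
          (ae_of_all _ fun ω => Finset.sum_nonneg fun i _ => abs_nonneg _)
          (integrable_finsetSum _ fun i _ => hint i) _
    _ = ∑ i, ∫ ω, |X i ω - truncation (X i) √n ω| ∂P := integral_finsetSum _ fun i _ => hint i
    _ ≤ ∑ _i : Fin n, V / √n := Finset.sum_le_sum fun i _ =>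
        (integral_abs_sub_truncation_le (hX i) hR).trans
          (div_le_div_of_nonneg_right (hV i) hR.le)
    _ = √n * V := by
        rw [Finset.sum_const, Finset.card_univ, Fintype.card_fin, nsmul_eq_mul]
        nth_rw 1 [← Real.mul_self_sqrt n.cast_nonneg]
        field_simp

lemma measureReal_exists_lt_norm_dft_le_of_memLp_two (hind : iIndepFun X P)
    (hX : ∀ i, MemLp (X i) 2 P) (hmean : ∀ i, ∫ ω, X i ω ∂P = 0)
    (hV : ∀ i, ∫ ω, X i ω ^ 2 ∂P ≤ V) (hn : 1 < n) :
    P.real {ω | ∃ z ∈ nthRootsFinset n (1 : ℂ), 3 * (√n * Real.log n) < ‖dft (X · ω) z‖} ≤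
      (4 * Real.exp (3 * V + 9 * (V * Real.exp 3)) + V) / Real.log n := by
  have := hind.isProbabilityMeasure
  have hn₀ : n ≠ 0 := by positivity
  have hlog : 0 < Real.log n := Real.log_pos (by exact_mod_cast hn)
  have hlog_le : Real.log n ≤ (n : ℝ) ^ 2 := by
    nlinarith [Real.log_le_sub_one_of_pos (show (0 : ℝ) < n by positivity)]
  set S := {ω | ∃ z ∈ nthRootsFinset n (1 : ℂ),
    2 * (√n * Real.log n) < ‖dft (fun i => truncation (X i) √n ω) z‖}
  set T := {ω | √n * Real.log n ≤ ∑ i, |X i ω - truncation (X i) √n ω|}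
  calc P.real {ω | ∃ z ∈ nthRootsFinset n (1 : ℂ), 3 * (√n * Real.log n) < ‖dft (X · ω) z‖}
      ≤ P.real (S ∪ T) := by
        refine measureReal_mono ?_
        rintro ω ⟨z, hz, hω⟩
        by_contra! hsmall
        simp only [S, T, Set.mem_union, Set.mem_ofPred_eq, not_or, not_exists, not_and, not_lt,
          not_le] at hsmall
        have hnorm : ‖z‖ = 1 := Complex.norm_eq_one_of_pow_eq_one
          ((mem_nthRootsFinset (Nat.pos_of_ne_zero hn₀) 1).1 hz) hn₀
        linarith [norm_dft_sub_le (X · ω) (fun i => truncation (X i) √n ω) hnorm,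
          hsmall.1 z hz, hsmall.2]
    _ ≤ P.real S + P.real T := measureReal_union_le S T
    _ ≤ 4 * Real.exp (3 * V + 9 * (V * Real.exp 3)) / Real.log n + V / Real.log n := by
        gcongr
        · exact (measureReal_exists_lt_norm_dft_truncation_le hind hX hmean hV hn₀).trans
            (by gcongr)
        · rw [le_div_iff₀' hlog]
          exact mul_measureReal_le_sum_abs_sub_truncation_le hX hV hn₀ _
    _ = (4 * Real.exp (3 * V + 9 * (V * Real.exp 3)) + V) / Real.log n := (add_div _ _ _).symm

lemma exists_measureReal_exists_lt_norm_dft_le_of_memLp_two {μ : Measure ℝ}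
    (h2 : MemLp (fun x : ℝ => x) 2 μ) (hmean : ∫ x, x ∂μ = 0) :
    ∃ C : ℝ, 0 < C ∧ ∀ (Ω : Type*) [MeasurableSpace Ω] (P : Measure Ω) (n : ℕ)
      (X : Fin n → Ω → ℝ), (∀ i, HasLaw (X i) μ P) → iIndepFun X P → 1 < n →
        P.real {ω | ∃ z ∈ nthRootsFinset n (1 : ℂ), 3 * (√n * Real.log n) < ‖dft (X · ω) z‖}
          ≤ C / Real.log n := by
  have : 0 ≤ ∫ x, x ^ 2 ∂μ := integral_nonneg fun x => sq_nonneg x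
  refine ⟨4 * Real.exp (3 * (∫ x, x ^ 2 ∂μ) + 9 * ((∫ x, x ^ 2 ∂μ) * Real.exp 3))
    + ∫ x, x ^ 2 ∂μ, by positivity, fun Ω _ P n X hlaw hind hn => ?_⟩
  refine measureReal_exists_lt_norm_dft_le_of_memLp_two hind (fun i => ?_)
    (fun i => (hlaw i).integral_eq.trans hmean) (fun i => ?_) hn
  · exact ((hlaw i).map_eq.symm ▸ h2).comp_of_map (hlaw i).aemeasurable
  · exact ((hlaw i).integral_comp (f := fun x : ℝ => x ^ 2) (by fun_prop)).le

end SecondMoment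

end UpperTail

section ConditionNumber

open Polynomial

variable {μ : Measure ℝ}

lemma one_sub_le_measureReal_conditionNumber_le {Ω : Type*} [MeasurableSpace Ω] (P : Measure Ω)
    [IsProbabilityMeasure P] (ξ : ℕ → Ω → ℝ) {n : ℕ} (hn : n ≠ 0) {a b : ℝ} (ha : 0 < a)
    (hb : 0 ≤ b) :
    1 - (P.real {ω | ∃ z ∈ nthRootsFinset n (1 : ℂ), ‖dft (fun i : Fin n => ξ i ω) z‖ < a}
      + P.real {ω | ∃ z ∈ nthRootsFinset n (1 : ℂ), b < ‖dft (fun i : Fin n => ξ i ω) z‖}) ≤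
      P.real {ω | conditionNumber (circulantMatrix n (fun j => ξ j ω)) ≤
        ENNReal.ofReal (b / a)} := by
  set A := {ω | ∃ z ∈ nthRootsFinset n (1 : ℂ), ‖dft (fun i : Fin n => ξ i ω) z‖ < a}
  set B := {ω | ∃ z ∈ nthRootsFinset n (1 : ℂ), b < ‖dft (fun i : Fin n => ξ i ω) z‖}
  set S := {ω | conditionNumber (circulantMatrix n (fun j => ξ j ω)) ≤ ENNReal.ofReal (b / a)}
  have hcover : (Set.univ : Set Ω) ⊆ S ∪ (A ∪ B) := by
    intro ω _
    by_cases h : ω ∈ A ∪ B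
    · exact Or.inr h
    · simp only [A, B, Set.mem_union, Set.mem_ofPred_eq, not_or, not_exists, not_and, not_lt] at h
      exact Or.inl (conditionNumber_circulantMatrix_le hn ha hb h.1 h.2)
  have hone := measureReal_mono (μ := P) hcover
  have hS := measureReal_union_le (μ := P) S (A ∪ B)
  have hAB := measureReal_union_le (μ := P) A B
  rw [probReal_univ] at hone
  linarith

lemma exists_one_sub_le_measureReal_conditionNumber_le_of_hasMGFNearZero [IsProbabilityMeasure μ]
    (hH : ConditionH μ) (hmgf : HasMGFNearZero μ) (hmean : ∫ x, x ∂μ = 0) :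
    ∃ A C : ℝ, 0 < A ∧ 0 < C ∧ ∀ᶠ n : ℕ in atTop, ∀ t : ℝ, 0 < t →
      ∀ (Ω : Type*) [MeasurableSpace Ω] (P : Measure Ω) [IsProbabilityMeasure P]
        (ξ : ℕ → Ω → ℝ), IsIID P μ ξ →
        1 - C * (t ^ 2 + 1 / √n) ≤
          P.real {ω | conditionNumber (circulantMatrix n (fun j => ξ j ω)) ≤
            ENNReal.ofReal (A * (√n * √(Real.log n)) / t)} := by
  obtain ⟨C, hC, hlower⟩ := exists_measureReal_exists_norm_dft_lt_le hH
  obtain ⟨A, hA, hupper⟩ := hmgf.exists_measureReal_exists_lt_norm_dft_le hmean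
  refine ⟨A, C + 4, hA, by positivity, ?_⟩
  filter_upwards [hupper, eventually_ge_atTop 1] with n hupper hn t ht Ω _ P _ ξ hξ
  have hind : iIndepFun (fun i : Fin n => ξ i) P := hξ.2.precomp Fin.val_injective
  have hsmall := hlower Ω P n _ (fun i => hξ.1 i) hind (by lia) t ht
  have hlarge := hupper Ω P _ (fun i => hξ.1 i) hind
  have hrate : 4 / (n : ℝ) ≤ 4 * (t ^ 2 + 1 / √n) := by
    have hsqrt : √(n : ℝ) ≤ n :=
      Real.sqrt_le_self_iff.2 (Or.inr (by exact_mod_cast hn))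
    calc 4 / (n : ℝ) = 4 * (1 / n) := by ring
      _ ≤ 4 * (0 + 1 / √n) := by rw [zero_add]; gcongr
      _ ≤ 4 * (t ^ 2 + 1 / √n) := by gcongr; positivity
  refine le_trans ?_ (one_sub_le_measureReal_conditionNumber_le P ξ (by lia) ht (by positivity))
  linarith

lemma exists_one_sub_le_measureReal_conditionNumber_le_of_memLp_two [IsProbabilityMeasure μ]
    (hH : ConditionH μ) (h2 : MemLp (fun x : ℝ => x) 2 μ) (hmean : ∫ x, x ∂μ = 0) :
    ∃ A C : ℝ, 0 < A ∧ 0 < C ∧ ∀ᶠ n : ℕ in atTop, ∀ t : ℝ, 0 < t →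
      ∀ (Ω : Type*) [MeasurableSpace Ω] (P : Measure Ω) [IsProbabilityMeasure P]
        (ξ : ℕ → Ω → ℝ), IsIID P μ ξ →
        1 - C * (t ^ 2 + 1 / Real.log n) ≤
          P.real {ω | conditionNumber (circulantMatrix n (fun j => ξ j ω)) ≤
            ENNReal.ofReal (A * (√n * Real.log n) / t)} := by
  obtain ⟨C, hC, hlower⟩ := exists_measureReal_exists_norm_dft_lt_le hH
  obtain ⟨C', hC', hupper⟩ := exists_measureReal_exists_lt_norm_dft_le_of_memLp_two h2 hmean
  refine ⟨3, 2 * C + C', by norm_num, by positivity, ?_⟩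
  filter_upwards [eventually_gt_atTop 1] with n hn t ht Ω _ P _ ξ hξ
  have hind : iIndepFun (fun i : Fin n => ξ i) P := hξ.2.precomp Fin.val_injective
  have hsmall := hlower Ω P n _ (fun i => hξ.1 i) hind (by lia) t ht
  have hlarge := hupper Ω P n _ (fun i => hξ.1 i) hind hn
  have hn0 : (0 : ℝ) < n := by exact_mod_cast (by lia : 0 < n)
  have hlog : 0 < Real.log n := Real.log_pos (by exact_mod_cast hn)
  have hrate : 1 / √(n : ℝ) ≤ 2 * (1 / Real.log n) := by
    rw [mul_one_div, div_le_div_iff₀ (Real.sqrt_pos.2 hn0) hlog]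
    linarith [one_add_log_le_two_mul_sqrt hn0]
  have hsmall_rate := mul_le_mul_of_nonneg_left hrate hC.le
  have : 0 ≤ (C + C') * t ^ 2 := by positivity
  refine le_trans ?_ (one_sub_le_measureReal_conditionNumber_le P ξ (by lia) ht (by positivity))
  rw [mul_add] at hsmall ⊢
  rw [div_eq_mul_one_div] at hlarge
  linarith

end ConditionNumber

lemma sq_mul_rpow_neg (ε ρ : ℝ) {x : ℝ} (hx : 0 ≤ x) :
    (ε * x ^ (-ρ)) ^ 2 = ε ^ 2 * x ^ (-2 * ρ) := by
  rw [mul_pow, ← Real.rpow_mul_natCast hx]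
  ring_nf

lemma mul_sqrt_mul_div_mul_rpow_neg (A ε ρ l : ℝ) {x : ℝ} (hx : 0 < x) :
    A * (√x * l) / (ε * x ^ (-ρ)) = A / ε * x ^ (ρ + 1 / 2) * l := by
  rw [Real.rpow_neg hx.le, Real.rpow_add hx, ← Real.sqrt_eq_rpow]
  field_simp

theorem mainTheorem1_general (μ : Measure ℝ) [IsProbabilityMeasure μ] (hH : ConditionH μ)
    (hmean : ∫ x, x ∂μ = 0) :
    (HasMGFNearZero μ →
      ∃ C₀ C₁ : ℝ, 0 < C₀ ∧ 0 < C₁ ∧ ∀ᶠ n : ℕ in atTop, ∀ ε : ℝ, 0 < ε → ∀ ρ : ℝ,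
          ∀ (Ω : Type*) [MeasurableSpace Ω] (P : Measure Ω) [IsProbabilityMeasure P]
            (ξ : ℕ → Ω → ℝ), IsIID P μ ξ →
            1 - C₁ * (ε ^ 2 * (n : ℝ) ^ (-2 * ρ) + (n : ℝ) ^ (-1 / 2 : ℝ)) ≤
              P.real {ω | conditionNumber (circulantMatrix n (fun j => ξ j ω)) ≤
                ENNReal.ofReal
                  (C₀ / ε * (n : ℝ) ^ (ρ + 1 / 2) * (Real.log n) ^ (1 / 2 : ℝ))}) ∧
    (MemLp (fun x : ℝ => x) 2 μ →
      ∃ C₀ C₂ : ℝ, 0 < C₀ ∧ 0 < C₂ ∧ ∀ᶠ n : ℕ in atTop, ∀ ε : ℝ, 0 < ε → ∀ ρ : ℝ,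
          ∀ (Ω : Type*) [MeasurableSpace Ω] (P : Measure Ω) [IsProbabilityMeasure P]
            (ξ : ℕ → Ω → ℝ), IsIID P μ ξ →
            1 - C₂ * (ε ^ 2 * (n : ℝ) ^ (-2 * ρ) + (Real.log n)⁻¹) ≤
              P.real {ω | conditionNumber (circulantMatrix n (fun j => ξ j ω)) ≤
                ENNReal.ofReal (C₀ / ε * (n : ℝ) ^ (ρ + 1 / 2) * Real.log n)}) := by
  refine ⟨fun hmgf => ?_, fun h2 => ?_⟩
  · obtain ⟨A, C, hA, hC, h⟩ :=
      exists_one_sub_le_measureReal_conditionNumber_le_of_hasMGFNearZero hH hmgf hmean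
    refine ⟨A, C, hA, hC, ?_⟩
    filter_upwards [h, eventually_gt_atTop 0] with n h hn ε hε ρ Ω _ P _ ξ hξ
    have hn0 : (0 : ℝ) < n := by exact_mod_cast hn
    have hrate : (n : ℝ) ^ (-1 / 2 : ℝ) = 1 / √n := by
      rw [neg_div, Real.rpow_neg hn0.le, ← Real.sqrt_eq_rpow, one_div]
    rw [hrate, ← sq_mul_rpow_neg ε ρ hn0.le, ← Real.sqrt_eq_rpow,
      ← mul_sqrt_mul_div_mul_rpow_neg A ε ρ _ hn0]
    exact h _ (by positivity) Ω P ξ hξ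
  · obtain ⟨A, C, hA, hC, h⟩ :=
      exists_one_sub_le_measureReal_conditionNumber_le_of_memLp_two hH h2 hmean
    refine ⟨A, C, hA, hC, ?_⟩
    filter_upwards [h, eventually_gt_atTop 0] with n h hn ε hε ρ Ω _ P _ ξ hξ
    have hn0 : (0 : ℝ) < n := by exact_mod_cast hn
    rw [← sq_mul_rpow_neg ε ρ hn0.le, ← one_div, ← mul_sqrt_mul_div_mul_rpow_neg A ε ρ _ hn0]
    exact h _ (by positivity) Ω P ξ hξ

lemma eventually_inv_log_le_log_rpow_neg_half :
    ∀ᶠ n : ℕ in atTop, (Real.log n)⁻¹ ≤ (Real.log n) ^ (-1 / 2 : ℝ) := by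
  filter_upwards [(Real.tendsto_log_atTop.comp tendsto_natCast_atTop_atTop).eventually_ge_atTop 1]
    with n hn
  rw [← Real.rpow_neg_one]
  exact Real.rpow_le_rpow_of_exponent_le hn (by norm_num)

theorem mainTheorem1 (μ : Measure ℝ) [IsProbabilityMeasure μ]
    (hH : ConditionH μ) (h2 : MemLp (fun x : ℝ => x) 2 μ) (hmean : ∫ x, x ∂μ = 0) :
    (0 < variance (fun x : ℝ => x) μ → HasMGFNearZero μ →
      ∃ C₀ C₁ : ℝ, 0 < C₀ ∧ 0 < C₁ ∧ ∃ δ : ℕ → ℝ, Tendsto δ atTop (𝓝 0) ∧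
        ∀ ε : ℝ, 0 < ε → ∀ ρ ∈ Set.Ioo (0 : ℝ) (1 / 4), ∀ᶠ n : ℕ in atTop,
          ∀ (Ω : Type*) [MeasurableSpace Ω] (P : Measure Ω) [IsProbabilityMeasure P]
            (ξ : ℕ → Ω → ℝ), IsIID P μ ξ →
            1 - C₁ * ((ε ^ 2 + ε) * (n : ℝ) ^ (-2 * ρ) + (n : ℝ) ^ (-1 / 2 + δ n)) ≤
              P.real {ω | conditionNumber (circulantMatrix n (fun j => ξ j ω)) ≤
                ENNReal.ofReal
                  (C₀ / ε * (n : ℝ) ^ (ρ + 1 / 2) * (Real.log n) ^ (1 / 2 : ℝ))}) ∧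
    (∃ C₀ C₂ : ℝ, 0 < C₀ ∧ 0 < C₂ ∧
        ∀ ε : ℝ, 0 < ε → ∀ ρ ∈ Set.Ioo (0 : ℝ) (1 / 4), ∀ᶠ n : ℕ in atTop,
          ∀ (Ω : Type*) [MeasurableSpace Ω] (P : Measure Ω) [IsProbabilityMeasure P]
            (ξ : ℕ → Ω → ℝ), IsIID P μ ξ →
            1 - C₂ * ((ε ^ 2 + ε) * (n : ℝ) ^ (-2 * ρ) + (Real.log n) ^ (-1 / 2 : ℝ)) ≤
              P.real {ω | conditionNumber (circulantMatrix n (fun j => ξ j ω)) ≤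
                ENNReal.ofReal (C₀ / ε * (n : ℝ) ^ (ρ + 1 / 2) * Real.log n)}) := by
  obtain ⟨hexp, hsq⟩ := mainTheorem1_general μ hH hmean
  constructor
  · intro _ hmgf
    obtain ⟨C₀, C₁, hC₀, hC₁, h⟩ := hexp hmgf
    refine ⟨C₀, C₁, hC₀, hC₁, fun _ => 0, tendsto_const_nhds, fun ε hε ρ _ => ?_⟩
    filter_upwards [h] with n h Ω _ P _ ξ hξ
    refine le_trans ?_ (h ε hε ρ Ω P ξ hξ)
    rw [add_zero]
    gcongr
    linarith
  · obtain ⟨C₀, C₂, hC₀, hC₂, h⟩ := hsq h2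
    refine ⟨C₀, C₂, hC₀, hC₂, fun ε hε ρ _ => ?_⟩
    filter_upwards [h, eventually_inv_log_le_log_rpow_neg_half] with n h hlog Ω _ P _ ξ hξ
    refine le_trans ?_ (h ε hε ρ Ω P ξ hξ)
    gcongr
    linarith
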